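/- Let $n\ge 0$, and let $V=\mathbb R^{1,n+1}$ be Minkowski space, with $g(u,v)=-u_0v_0+\sum_{i=1}^{n+1}u_iv_i$. Let $\mathfrak{so}(V)=\mathfrak{so}(1,n+1)$ be its Lorentz algebra, and let $SO^0(V)\subset SO(V)$ be the connected Lie subgroup with Lie algebra $\mathfrak{so}(V)$. Let $p,q\in V$ be isotropic with $g(p,q)=1$, and put $U=\mathbb Rp+\mathbb Rq$ and $E=U^\perp$ (a Euclidean space of dimension $n$). For a subspace $H\subseteq E$ put $V(H)=\mathbb Rp+H+\mathbb Rq$, a Lorentzian subspace. Write $p\wedge q$ for the endomorphism $x\mapsto g(q,x)p-g(p,x)q$. For a non-degenerate subspace $W\subseteq V$ regard $\mathfrak{so}(W)\subset\mathfrak{so}(V)$ and $SO(W)\subset SO(V)$, acting trivially on $W^\perp$, and let $SO^0(W)$ be the connected Lie subgroup with Lie algebra $\mathfrak{so}(W)$. Let $\mathfrak{so}(n+1)$ and $SO(n+1)$ denote $\mathfrak{so}(e_0^\perp)$ and $SO(e_0^\perp)$, where $e_0=(1,0,\dots,0)$. A set of endomorphisms of $V$ is called totally reducible if every invariant subspace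 of $V$ has an invariant complement. A real Lie algebra is called compact if it admits an $\mathrm{ad}$-invariant inner product. (a) Every totally reducible Lie subalgebra $\mathfrak h\subseteq\mathfrak{so}(V)$ is conjugate, by an element of $SO^0(V)$, to a subalgebra of one of the following types: * Type I: a subalgebra of $\mathfrak{so}(n+1)$; * Type II: a subalgebra of the form $\mathfrak{so}(W)+\mathfrak k$, where $W=V(H)$ for some subspace $H\subseteq E$, $\dim W\ge 3$, and $\mathfrak k$ is a compact subalgebra of $\mathfrak{so}(W^\perp)$; * Type III: a subalgebra of the form $\mathbb Rd\oplus\mathfrak k$, where $d=p\wedge q+C_0$ with $C_0\in\mathfrak{so}(E)$ (possibly zero), and $\mathfrak k$ is a subalgebra of the centralizer of $C_0$ in $\mathfrak{so}(E)$. (b) Every totally reducible connected Lie subgroup of $SO(V)$ (not necessarily closed) is conjugate, by an element of $SO^0(V)$, to a subgroup of one of the following types: * Type I: a connected Lie subgroup of $SO(n+1)$; * Type II: a subgroup of the form $SO^0(W)\cdot K$, where $W=V(H)$ for some subspace $H\subseteq E$, $\dim W\ge 3$, and $K$ is a connected Lie subgroup of $SO(W^\perp)$; * Type III: a subgroup of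 the form $T\cdot K$, where $K$ is a connected Lie subgroup of $SO(E)$ and $T$ is a one-parameter subgroup of $SO(U)\times SO(E)$ that is not contained in $SO(E)$ and commutes with $K$. -/

import Mathlib

open scoped Matrix Pointwise

attribute [local instance 100] LieRing.ofAssociativeRing

noncomputable section

namespace Lorentz

/-- The underlying vector space `ℝ^{n+2}` of Minkowski space `ℝ^{1,n+1}`. -/
abbrev Vec (n : ℕ) : Type := Fin (n + 2) → ℝ

/-- Endomorphisms of `Vec n`, as matrices in the standard basis. -/
abbrev Mat (n : ℕ) : Type := Matrix (Fin (n + 2)) (Fin (n + 2)) ℝ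

/-- The Gram matrix `diag(-1, 1, …, 1)` of the Minkowski metric. -/
def gram (n : ℕ) : Mat n := Matrix.diagonal fun i => if i = 0 then -1 else 1

/-- The Minkowski metric `g(u,v) = -u₀v₀ + ∑_{i ≥ 1} uᵢvᵢ`. -/
def g (n : ℕ) : LinearMap.BilinForm ℝ (Vec n) := Matrix.toBilin' (gram n)

theorem g_apply (n : ℕ) (u v : Vec n) :
    g n u v = -(u 0 * v 0) + ∑ i : Fin (n + 1), u i.succ * v i.succ := by
  rw [g, Matrix.toBilin'_apply', gram, dotProduct, Fin.sum_univ_succ]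
  simp [Matrix.mulVec_diagonal]

/-- The orthogonal complement of a subspace with respect to the Minkowski metric. -/
def orth {n : ℕ} (W : Submodule ℝ (Vec n)) : Submodule ℝ (Vec n) := (g n).orthogonal W

/-- The Lorentz algebra `so(V) = so(1,n+1)` of `g`-skew-symmetric endomorphisms. -/
def so (n : ℕ) : LieSubalgebra ℝ (Mat n) := skewAdjointMatricesLieSubalgebra (gram n)

/-- For a non-degenerate subspace `W`, the algebra `so(W)`, embedded into `so(V)` through
`V = W ⊕ W^⊥`: the elements of `so(V)` that vanish on `W^⊥`. -/
def soSub {n : ℕ} (W : Submodule ℝ (Vec n)) : LieSubalgebra ℝ (Mat n) where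
  carrier := {A | A ∈ so n ∧ ∀ v ∈ orth W, A *ᵥ v = 0}
  add_mem' := fun {A B} hA hB =>
    ⟨add_mem hA.1 hB.1, fun v hv => by rw [Matrix.add_mulVec, hA.2 v hv, hB.2 v hv, add_zero]⟩
  zero_mem' := ⟨zero_mem _, fun v _ => Matrix.zero_mulVec v⟩
  smul_mem' := fun c A hA =>
    ⟨(so n).smul_mem c hA.1, fun v hv => by rw [Matrix.smul_mulVec, hA.2 v hv, smul_zero]⟩
  lie_mem' := fun {A B} hA hB =>
    ⟨(so n).lie_mem hA.1 hB.1, fun v hv => by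
      rw [Ring.lie_def, Matrix.sub_mulVec, ← Matrix.mulVec_mulVec, ← Matrix.mulVec_mulVec,
        hA.2 v hv, hB.2 v hv, Matrix.mulVec_zero, Matrix.mulVec_zero, sub_zero]⟩

/-- For a non-degenerate subspace `W`, the group `SO(W)`, embedded into `SO(V)` through
`V = W ⊕ W^⊥`: the linear isometries of `V` of determinant one that fix `W^⊥` pointwise.
In particular `SO ⊤` is `SO(V)`. -/
def SO {n : ℕ} (W : Submodule ℝ (Vec n)) : Subgroup (GL (Fin (n + 2)) ℝ) where
  carrier := {a | (∀ u v : Vec n, g n ((a : Mat n) *ᵥ u) ((a : Mat n) *ᵥ v) = g n u v) ∧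
    (a : Mat n).det = 1 ∧ ∀ v ∈ orth W, (a : Mat n) *ᵥ v = v}
  mul_mem' := fun {a b} ha hb => by
    refine ⟨fun u v => ?_, ?_, fun v hv => ?_⟩
    · rw [Units.val_mul, ← Matrix.mulVec_mulVec, ← Matrix.mulVec_mulVec, ha.1, hb.1]
    · rw [Units.val_mul, Matrix.det_mul, ha.2.1, hb.2.1, one_mul]
    · rw [Units.val_mul, ← Matrix.mulVec_mulVec, hb.2.2 v hv, ha.2.2 v hv]
  one_mem' := by
    refine ⟨fun u v => ?_, ?_, fun v _ => ?_⟩ <;> simp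
  inv_mem' := fun {a} ha => by
    have key : ∀ v : Vec n, (a : Mat n) *ᵥ ((a⁻¹ : GL (Fin (n + 2)) ℝ) : Mat n) *ᵥ v = v := by
      intro v
      rw [Matrix.mulVec_mulVec, ← Units.val_mul, mul_inv_cancel, Units.val_one, Matrix.one_mulVec]
    have key' : ∀ v : Vec n, ((a⁻¹ : GL (Fin (n + 2)) ℝ) : Mat n) *ᵥ (a : Mat n) *ᵥ v = v := by
      intro v
      rw [Matrix.mulVec_mulVec, ← Units.val_mul, inv_mul_cancel, Units.val_one, Matrix.one_mulVec]
    refine ⟨fun u v => ?_, ?_, fun v hv => ?_⟩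
    · rw [← ha.1, key, key]
    · have h : (a : Mat n).det * ((a⁻¹ : GL (Fin (n + 2)) ℝ) : Mat n).det = 1 := by
        rw [← Matrix.det_mul, ← Units.val_mul, mul_inv_cancel, Units.val_one, Matrix.det_one]
      rwa [ha.2.1, one_mul] at h
    · conv_lhs => rw [← ha.2.2 v hv]
      exact key' v

/-- The connected Lie subgroup of `GL(V)` with Lie algebra `h`, that is, the subgroup generated
by the exponentials of the elements of `h`. -/
def lieSubgroup {n : ℕ} (h : LieSubalgebra ℝ (Mat n)) : Subgroup (GL (Fin (n + 2)) ℝ) :=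
  Subgroup.closure {a | ∃ X ∈ h, (a : Mat n) = NormedSpace.exp X}

/-- Connected Lie subgroups of `GL(V)` (not necessarily closed). -/
def IsConnectedLieSubgroup {n : ℕ} (G : Subgroup (GL (Fin (n + 2)) ℝ)) : Prop :=
  ∃ h : LieSubalgebra ℝ (Mat n), G = lieSubgroup h

/-- The connected Lorentz group `SO⁰(V)`. -/
def SO0 (n : ℕ) : Subgroup (GL (Fin (n + 2)) ℝ) := lieSubgroup (so n)

/-- `U` is invariant under all members of the set `S` of endomorphisms. -/
def Invariant {n : ℕ} (S : Set (Mat n)) (U : Submodule ℝ (Vec n)) : Prop :=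
  ∀ A ∈ S, ∀ u ∈ U, A *ᵥ u ∈ U

/-- Total reducibility of the action on `V` of a set `S` of endomorphisms: every invariant
subspace has an invariant complement. -/
def TotallyReducible {n : ℕ} (S : Set (Mat n)) : Prop :=
  ∀ U : Submodule ℝ (Vec n), Invariant S U → ∃ U', Invariant S U' ∧ IsCompl U U'

/-- The conjugate subalgebra `a h a⁻¹`. -/
def conj {n : ℕ} (a : GL (Fin (n + 2)) ℝ) (h : LieSubalgebra ℝ (Mat n)) :
    LieSubalgebra ℝ (Mat n) where
  carrier := {A | ∃ X ∈ h, A = a.1 * X * (a⁻¹).1}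
  add_mem' := by
    rintro _ _ ⟨X, hX, rfl⟩ ⟨Y, hY, rfl⟩
    exact ⟨X + Y, add_mem hX hY, by noncomm_ring⟩
  zero_mem' := ⟨0, zero_mem _, by simp⟩
  smul_mem' := by
    rintro c _ ⟨X, hX, rfl⟩
    exact ⟨c • X, h.smul_mem c hX, by simp⟩
  lie_mem' := by
    rintro _ _ ⟨X, hX, rfl⟩ ⟨Y, hY, rfl⟩
    refine ⟨⁅X, Y⁆, h.lie_mem hX hY, ?_⟩
    have e : (a⁻¹).1 * a.1 = 1 := by rw [← Units.val_mul, inv_mul_cancel, Units.val_one]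
    have e' : ∀ P Q : Mat n, (a.1 * P * (a⁻¹).1) * (a.1 * Q * (a⁻¹).1) =
        a.1 * (P * Q) * (a⁻¹).1 := fun P Q => by
      rw [show (a.1 * P * (a⁻¹).1) * (a.1 * Q * (a⁻¹).1) =
        a.1 * P * ((a⁻¹).1 * a.1) * Q * (a⁻¹).1 by noncomm_ring, e]
      noncomm_ring
    simp only [Ring.lie_def]
    rw [e', e', mul_sub, sub_mul]

/-- The conjugate subgroup `a G a⁻¹`. -/
def conjGroup {n : ℕ} (a : GL (Fin (n + 2)) ℝ) (G : Subgroup (GL (Fin (n + 2)) ℝ)) :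
    Subgroup (GL (Fin (n + 2)) ℝ) :=
  G.map (MulAut.conj a).toMonoidHom

/-- A compact Lie algebra: a real Lie algebra with an ad-invariant inner product. -/
def IsCompactLieAlgebra (L : Type*) [LieRing L] [LieAlgebra ℝ L] : Prop :=
  ∃ B : LinearMap.BilinForm ℝ L, B.IsSymm ∧ (∀ x, x ≠ 0 → 0 < B x x) ∧
    ∀ x y z : L, B ⁅x, y⁆ z + B y ⁅x, z⁆ = 0

/-- The bivector `u ∧ v` as a skew-symmetric endomorphism, `x ↦ g(v,x) u - g(u,x) v`. -/
def wedge {n : ℕ} (u v : Vec n) : Mat n :=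
  Matrix.vecMulVec u (gram n *ᵥ v) - Matrix.vecMulVec v (gram n *ᵥ u)

/-- `p, q` are isotropic with `g(p,q) = 1`, i.e. they are the isotropic vectors of a Witt basis. -/
structure IsWittPair {n : ℕ} (p q : Vec n) : Prop where
  left : g n p p = 0
  right : g n q q = 0
  pair : g n p q = 1

/-- The Minkowski plane `U = ℝp + ℝq`. -/
def planeU {n : ℕ} (p q : Vec n) : Submodule ℝ (Vec n) := Submodule.span ℝ {p, q}

/-- The Euclidean space `E = U^⊥`. -/
def spaceE {n : ℕ} (p q : Vec n) : Submodule ℝ (Vec n) := orth (planeU p q)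

/-- The Lorentzian subspace `V(H) = ℝp + H + ℝq`, for `H ⊆ E`. -/
def spaceV {n : ℕ} (p q : Vec n) (H : Submodule ℝ (Vec n)) : Submodule ℝ (Vec n) :=
  Submodule.span ℝ {p} ⊔ H ⊔ Submodule.span ℝ {q}

/-- The Euclidean hyperplane orthogonal to the timelike basis vector `(1, 0, …, 0)`; its algebra
`so(n+1)` and group `SO(n+1)` are the standard maximal compact ones. -/
def euclideanHyperplane (n : ℕ) : Submodule ℝ (Vec n) :=
  orth (Submodule.span ℝ {Pi.single 0 1})

/-- Type I: subalgebras of the maximal compact subalgebra `so(n+1)`. -/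
def IsTypeI {n : ℕ} (h : LieSubalgebra ℝ (Mat n)) : Prop :=
  h ≤ soSub (euclideanHyperplane n)

/-- Type II: `so(W) + k`, with `W = V(H)` of dimension at least three and `k` a compact
subalgebra of `so(W^⊥)`. -/
def IsTypeII {n : ℕ} (p q : Vec n) (h : LieSubalgebra ℝ (Mat n)) : Prop :=
  ∃ H ≤ spaceE p q, 3 ≤ Module.finrank ℝ (spaceV p q H) ∧
    ∃ k : LieSubalgebra ℝ (Mat n), k ≤ soSub (orth (spaceV p q H)) ∧ IsCompactLieAlgebra k ∧
      h.toSubmodule = (soSub (spaceV p q H)).toSubmodule ⊔ k.toSubmodule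

/-- Type III: `ℝd ⊕ k`, with `d = p ∧ q + C₀`, `C₀ ∈ so(E)`, and `k` a subalgebra of the
centralizer of `C₀` in `so(E)`. -/
def IsTypeIII {n : ℕ} (p q : Vec n) (h : LieSubalgebra ℝ (Mat n)) : Prop :=
  ∃ C₀ ∈ soSub (spaceE p q), ∃ k : LieSubalgebra ℝ (Mat n),
    k ≤ soSub (spaceE p q) ∧ (∀ X ∈ k, ⁅C₀, X⁆ = 0) ∧
      Disjoint (Submodule.span ℝ {wedge p q + C₀}) k.toSubmodule ∧
      h.toSubmodule = Submodule.span ℝ {wedge p q + C₀} ⊔ k.toSubmodule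

/-- Type I groups: connected subgroups of `SO(n+1)`. -/
def IsGroupTypeI {n : ℕ} (G : Subgroup (GL (Fin (n + 2)) ℝ)) : Prop :=
  IsConnectedLieSubgroup G ∧ G ≤ SO (euclideanHyperplane n)

/-- Type II groups: `SO⁰(W) · K`, with `W = V(H)` of dimension at least three and `K` a
connected subgroup of `SO(W^⊥)`. -/
def IsGroupTypeII {n : ℕ} (p q : Vec n) (G : Subgroup (GL (Fin (n + 2)) ℝ)) : Prop :=
  ∃ H ≤ spaceE p q, 3 ≤ Module.finrank ℝ (spaceV p q H) ∧
    ∃ K : Subgroup (GL (Fin (n + 2)) ℝ), IsConnectedLieSubgroup K ∧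
      K ≤ SO (orth (spaceV p q H)) ∧
      (G : Set (GL (Fin (n + 2)) ℝ)) = (lieSubgroup (soSub (spaceV p q H)) : Set (GL (Fin (n + 2)) ℝ)) * (K : Set (GL (Fin (n + 2)) ℝ))

/-- Type III groups: `T · K`, with `K` a connected subgroup of `SO(E)` and `T` a one-parameter
subgroup of `SO(1,1) × SO(E)` that is not contained in `SO(E)` and commutes with `K`. -/
def IsGroupTypeIII {n : ℕ} (p q : Vec n) (G : Subgroup (GL (Fin (n + 2)) ℝ)) : Prop :=
  ∃ φ : Multiplicative ℝ →* GL (Fin (n + 2)) ℝ, Continuous φ ∧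
    φ.range ≤ SO (planeU p q) ⊔ SO (spaceE p q) ∧ ¬ φ.range ≤ SO (spaceE p q) ∧
    ∃ K : Subgroup (GL (Fin (n + 2)) ℝ), IsConnectedLieSubgroup K ∧ K ≤ SO (spaceE p q) ∧
      (∀ t ∈ φ.range, ∀ k ∈ K, t * k = k * t) ∧
      (G : Set (GL (Fin (n + 2)) ℝ)) = (φ.range : Set (GL (Fin (n + 2)) ℝ)) * (K : Set (GL (Fin (n + 2)) ℝ))

end Lorentz

end

namespace Lorentz

variable {n : ℕ}

/-! ### The Minkowski metric -/

/-! Call an element of `so n` hyperbolic if it has a nonzero real eigenvalue. The type of a totally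
reducible algebra `h` depends on whether `h` preserves a null line and whether it contains a
hyperbolic element.

No invariant null line, no hyperbolic element. A non-hyperbolic `X` kills a causal vector, so tr X²
≤ 0, with equality only for nilpotent `X`. The radical of the trace form then consists of
nilpotents, and Engel's theorem with total reducibility makes it zero. Thus minus the trace form is
an invariant inner product on `h`, with a Casimir matrix C = ∑ Aᵢ². Maximising -g(v,v) / ∑ g(Aᵢv,
Aᵢv) on the causal cone yields a common causal eigenvector or a timelike eigenvector of C with
eigenvalue c > 0. In the second case C has trace c · dim K > 0 on its eigenspace K, whereas it is a
sum of squares of non-hyperbolic elements there, so the trace is at most zero. Hence a timelike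
vector is killed, and `h` has type I (`exists_timelike_of_not_hyperbolic`).

No invariant null line, some hyperbolic element. Up to conjugation and scaling it is A = p∧q + C
with C in so(E). In a frame with p - q on the time axis, p∧q is symmetric and C is skew, and they
commute. So ad A is normal, `h` is stable under its adjoint, and therefore under ad(p∧q)
(`IsWittPair.lie_wedge_mem`). Its eigenspaces give bivectors p∧x and q∧y in `h`, which generate
so(V(H)) for one subspace H of E; what remains acts on the orthogonal complement of V(H): type II.

An invariant null line ℝp. Total reducibility provides a second invariant null line ℝq, on which `h`
acts by the opposite character. If the character vanishes, p - q is killed and the type is I.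
Otherwise an element with nonzero character, made trace-orthogonal to the compact algebra k = h ∩
so(E), centralises k: type III.

For groups, `h` and the group it generates have the same invariant subspaces, and the sums of
commuting pieces exponentiate to products. -/

theorem g_eq_dotProduct (u v : Vec n) : g n u v = u ⬝ᵥ (gram n *ᵥ v) := by
  rw [g, Matrix.toBilin'_apply']

theorem gram_mul_gram (n : ℕ) : gram n * gram n = 1 := by
  rw [gram, Matrix.diagonal_mul_diagonal, ← Matrix.diagonal_one]
  congr 1
  ext i
  split_ifs <;> norm_num

theorem gram_mulVec_gram_mulVec (v : Vec n) : gram n *ᵥ (gram n *ᵥ v) = v := by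
  rw [Matrix.mulVec_mulVec, gram_mul_gram, Matrix.one_mulVec]

theorem g_comm (u v : Vec n) : g n u v = g n v u := by
  rw [g_apply, g_apply, mul_comm (u 0)]
  simp only [mul_comm]

theorem g_isRefl (n : ℕ) : (g n).IsRefl := fun u v h => by rw [g_comm]; exact h

theorem g_isSymm (n : ℕ) : (g n).IsSymm := ⟨fun u v => g_comm u v⟩

theorem g_gram_left (u v : Vec n) : g n (gram n *ᵥ u) v = u ⬝ᵥ v := by
  rw [g_comm, g_eq_dotProduct, gram_mulVec_gram_mulVec, dotProduct_comm]

theorem eq_zero_of_g_eq_zero {v : Vec n} (h : ∀ u, g n u v = 0) : v = 0 := by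
  have := h (gram n *ᵥ v)
  rw [g_gram_left] at this
  exact dotProduct_self_eq_zero.1 this

theorem eq_of_g_eq {v w : Vec n} (h : ∀ u, g n u v = g n u w) : v = w :=
  sub_eq_zero.1 (eq_zero_of_g_eq_zero fun u => by rw [map_sub, h, sub_self])

theorem g_nondegenerate (n : ℕ) : (g n).Nondegenerate :=
  ⟨fun v h => eq_zero_of_g_eq_zero fun u => by rw [g_comm]; exact h u,
    fun v h => eq_zero_of_g_eq_zero h⟩

theorem mem_orth {W : Submodule ℝ (Vec n)} {v : Vec n} : v ∈ orth W ↔ ∀ w ∈ W, g n w v = 0 :=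
  Iff.rfl

theorem orth_orth (W : Submodule ℝ (Vec n)) : orth (orth W) = W :=
  LinearMap.BilinForm.orthogonal_orthogonal (g_nondegenerate n) (g_isRefl n) W

/-- The orthogonal complement of a causal vector is positive semidefinite, with radical spanned by
that vector. -/
theorem g_self_nonneg_of_orth {v w : Vec n} (hv : g n v v ≤ 0) (hv0 : v ≠ 0) (h : g n v w = 0) :
    0 ≤ g n w w ∧ (g n w w = 0 → ∃ c : ℝ, w = c • v) := by
  have h0 : v 0 ≠ 0 := by
    intro h0
    apply hv0
    have hs : ∑ i : Fin (n + 1), v i.succ * v i.succ ≤ 0 := by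
      rw [g_apply, h0] at hv; simpa using hv
    have hz := (Finset.sum_eq_zero_iff_of_nonneg fun i _ => mul_self_nonneg (v (Fin.succ i))).1
      (le_antisymm hs (Finset.sum_nonneg fun i _ => mul_self_nonneg _))
    ext i
    refine Fin.cases h0 (fun j => ?_) i
    exact mul_self_eq_zero.1 (hz j (Finset.mem_univ _))
  set c := w 0 / v 0 with hc
  set w' := w - c • v with hw'
  have hw0 : w' 0 = 0 := by simp [hw', hc, div_mul_cancel₀ _ h0]
  have e1 : g n w' w' = ∑ i : Fin (n + 1), w' i.succ * w' i.succ := by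
    rw [g_apply, hw0]; simp
  have e2 : g n w' w' = g n w w + c ^ 2 * g n v v := by
    simp only [hw', map_sub, map_smul, LinearMap.sub_apply, LinearMap.smul_apply, smul_eq_mul, h,
      g_comm w v]
    ring
  have hle : g n w' w' ≤ g n w w := by nlinarith [sq_nonneg c]
  have hge : 0 ≤ g n w' w' := by rw [e1]; exact Finset.sum_nonneg fun i _ => mul_self_nonneg _
  refine ⟨hge.trans hle, fun hz => ⟨c, ?_⟩⟩
  have hz' : g n w' w' = 0 := le_antisymm (hle.trans hz.le) hge
  have hz2 := (Finset.sum_eq_zero_iff_of_nonneg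
    fun i _ => mul_self_nonneg (w' (Fin.succ i))).1 (e1 ▸ hz')
  rw [← sub_eq_zero]
  change w' = 0
  ext i
  refine Fin.cases hw0 (fun j => ?_) i
  exact mul_self_eq_zero.1 (hz2 j (Finset.mem_univ _))

theorem g_self_pos_of_orth {v w : Vec n} (hv : g n v v < 0) (h : g n v w = 0) (hw : w ≠ 0) :
    0 < g n w w := by
  have hv0 : v ≠ 0 := by rintro rfl; simp at hv
  obtain ⟨h1, h2⟩ := g_self_nonneg_of_orth hv.le hv0 h
  refine lt_of_le_of_ne h1 fun hz => ?_
  obtain ⟨c, rfl⟩ := h2 hz.symm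
  rw [map_smul, smul_eq_mul, mul_eq_zero] at h
  rcases h with h | h
  · exact hw (by rw [h, zero_smul])
  · exact hv.ne h

/-! ### Skew-symmetric endomorphisms and bivectors -/

theorem mat_ext {A B : Mat n} (h : ∀ v, A *ᵥ v = B *ᵥ v) : A = B :=
  Matrix.mulVec_injective (funext h)

theorem mem_so {X : Mat n} : X ∈ so n ↔ ∀ u v, g n (X *ᵥ u) v = -g n u (X *ᵥ v) := by
  rw [so, mem_skewAdjointMatricesLieSubalgebra, mem_skewAdjointMatricesSubmodule,
    Matrix.IsSkewAdjoint, Matrix.IsAdjointPair]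
  have h1 : ∀ u v, g n (X *ᵥ u) v = u ⬝ᵥ ((Xᵀ * gram n) *ᵥ v) := fun u v => by
    rw [g_eq_dotProduct, ← Matrix.mulVec_mulVec, Matrix.dotProduct_mulVec u,
      Matrix.vecMul_transpose]
  have h2 : ∀ u v, -g n u (X *ᵥ v) = u ⬝ᵥ ((gram n * -X) *ᵥ v) := fun u v => by
    rw [g_eq_dotProduct, mul_neg, Matrix.neg_mulVec, dotProduct_neg, Matrix.mulVec_mulVec]
  simp only [h1, h2]
  refine ⟨fun h u v => by rw [h], fun h => ?_⟩
  refine mat_ext fun v => ?_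
  rw [← sub_eq_zero, ← dotProduct_self_eq_zero, dotProduct_sub, h, sub_self]

theorem so_skew {X : Mat n} (hX : X ∈ so n) (u v : Vec n) :
    g n (X *ᵥ u) v = -g n u (X *ᵥ v) := mem_so.1 hX u v

theorem so_self {X : Mat n} (hX : X ∈ so n) (u : Vec n) : g n u (X *ᵥ u) = 0 := by
  have := so_skew hX u u
  rw [g_comm] at this
  linarith

theorem wedge_mulVec (u v x : Vec n) : wedge u v *ᵥ x = g n v x • u - g n u x • v := by
  have h : ∀ u v : Vec n, Matrix.vecMulVec u (gram n *ᵥ v) *ᵥ x = g n v x • u := fun u v => by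
    rw [Matrix.vecMulVec_mulVec, g_comm, g_eq_dotProduct, dotProduct_comm]
    simp
  rw [wedge, Matrix.sub_mulVec, h, h]

theorem wedge_mem_so (u v : Vec n) : wedge u v ∈ so n := by
  rw [mem_so]
  intro x y
  simp only [wedge_mulVec, map_sub, map_smul, LinearMap.sub_apply, LinearMap.smul_apply,
    smul_eq_mul, g_comm x]
  ring

theorem wedge_swap (u v : Vec n) : wedge u v = -wedge v u := (neg_sub _ _).symm

theorem wedge_self (u : Vec n) : wedge u u = 0 := sub_self _

theorem wedge_add_left (u u' v : Vec n) : wedge (u + u') v = wedge u v + wedge u' v :=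
  mat_ext fun x => by
    simp only [wedge_mulVec, Matrix.add_mulVec, map_add, LinearMap.add_apply, smul_add, add_smul]
    abel

theorem wedge_smul_left (c : ℝ) (u v : Vec n) : wedge (c • u) v = c • wedge u v :=
  mat_ext fun x => by
    simp only [wedge_mulVec, Matrix.smul_mulVec, map_smul, LinearMap.smul_apply, smul_sub,
      smul_smul, smul_eq_mul]
    simp only [mul_comm]

theorem wedge_add_right (u v v' : Vec n) : wedge u (v + v') = wedge u v + wedge u v' := by
  rw [wedge_swap, wedge_add_left, wedge_swap u v, wedge_swap u v', neg_add]

theorem wedge_smul_right (c : ℝ) (u v : Vec n) : wedge u (c • v) = c • wedge u v := by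
  rw [wedge_swap, wedge_smul_left, wedge_swap u v, smul_neg]

theorem wedge_neg_left (u v : Vec n) : wedge (-u) v = -wedge u v := by
  rw [← neg_one_smul ℝ u, wedge_smul_left, neg_one_smul]

theorem wedge_neg_right (u v : Vec n) : wedge u (-v) = -wedge u v := by
  rw [wedge_swap, wedge_neg_left, wedge_swap u v]

theorem wedge_sub_right (u v v' : Vec n) : wedge u (v - v') = wedge u v - wedge u v' := by
  rw [sub_eq_add_neg, wedge_add_right, wedge_neg_right, ← sub_eq_add_neg]

theorem wedge_zero_left (v : Vec n) : wedge 0 v = 0 := by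
  simpa using wedge_smul_left 0 (0 : Vec n) v

theorem wedge_zero_right (v : Vec n) : wedge v 0 = 0 := by
  rw [wedge_swap, wedge_zero_left, neg_zero]

theorem lie_wedge {X : Mat n} (hX : X ∈ so n) (u v : Vec n) :
    ⁅X, wedge u v⁆ = wedge (X *ᵥ u) v + wedge u (X *ᵥ v) := by
  refine mat_ext fun x => ?_
  rw [Ring.lie_def, Matrix.sub_mulVec, ← Matrix.mulVec_mulVec, ← Matrix.mulVec_mulVec,
    Matrix.add_mulVec]
  simp only [wedge_mulVec, Matrix.mulVec_sub, Matrix.mulVec_smul, so_skew hX, neg_smul]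
  abel

theorem trace_mul_wedge (Y : Mat n) (u v : Vec n) :
    (Y * wedge u v).trace = g n v (Y *ᵥ u) - g n u (Y *ᵥ v) := by
  have h : ∀ u v : Vec n, (Y * Matrix.vecMulVec u (gram n *ᵥ v)).trace = g n v (Y *ᵥ u) := by
    intro u v
    rw [Matrix.mul_vecMulVec, Matrix.trace_vecMulVec, g_comm, g_eq_dotProduct]
  rw [wedge, mul_sub, Matrix.trace_sub, h, h]

theorem lie_mulVec (X Y : Mat n) (v : Vec n) : ⁅X, Y⁆ *ᵥ v = X *ᵥ (Y *ᵥ v) - Y *ᵥ (X *ᵥ v) := by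
  rw [Ring.lie_def, Matrix.sub_mulVec, Matrix.mulVec_mulVec, Matrix.mulVec_mulVec]

theorem trace_lie_mul (X Y Z : Mat n) : (⁅X, Y⁆ * Z).trace = (X * ⁅Y, Z⁆).trace := by
  rw [Ring.lie_def, Ring.lie_def, sub_mul, mul_sub, Matrix.trace_sub, Matrix.trace_sub,
    mul_assoc X Y Z, mul_assoc Y X Z, Matrix.trace_mul_comm Y (X * Z), mul_assoc X Z Y]

theorem so_transpose {X : Mat n} (hX : X ∈ so n) (v : Vec n) :
    Xᵀ *ᵥ v = -(gram n *ᵥ (X *ᵥ (gram n *ᵥ v))) := by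
  refine eq_of_g_eq fun u => ?_
  rw [map_neg, ← gram_mulVec_gram_mulVec u, g_gram_left, g_gram_left, ← dotProduct_neg,
    Matrix.dotProduct_mulVec, Matrix.vecMul_transpose]
  have := so_skew hX (gram n *ᵥ u) (gram n *ᵥ v)
  rw [g_gram_left, g_comm, g_gram_left, dotProduct_comm] at this
  rw [this, ← g_gram_left (gram n *ᵥ u), gram_mulVec_gram_mulVec, g_comm u, map_neg,
    LinearMap.neg_apply, g_gram_left, dotProduct_comm]

/-- An element killing the time axis also maps into its orthogonal hyperplane, where `g` is the dot
product; skewness for `g` is then ordinary skewness. -/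
theorem transpose_eq_neg_of_mulVec_time {X : Mat n} (hX : X ∈ so n) {c : ℝ} (hc : c ≠ 0)
    (h : X *ᵥ (c • Pi.single 0 1) = 0) : Xᵀ = -X := by
  have h0 : X *ᵥ Pi.single 0 1 = 0 := by
    rw [Matrix.mulVec_smul] at h
    exact (smul_eq_zero.1 h).resolve_left hc
  have hg : ∀ v : Vec n, gram n *ᵥ v = v - (2 * v 0) • Pi.single 0 1 := fun v => by
    ext i
    rw [gram, Matrix.mulVec_diagonal]
    refine Fin.cases ?_ (fun j => ?_) i
    · simp; ring
    · simp
  refine mat_ext fun v => ?_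
  rw [so_transpose hX, Matrix.neg_mulVec, neg_inj, hg v, Matrix.mulVec_sub, Matrix.mulVec_smul, h0,
    smul_zero, sub_zero, hg]
  have hz : (X *ᵥ v) 0 = 0 := by
    have h1 := so_skew hX (Pi.single 0 1) v
    rw [h0, map_zero, LinearMap.zero_apply, g_apply] at h1
    simpa using h1.symm
  rw [hz]; simp

/-! ### Matrix exponentials -/

section Exponential

open scoped Matrix.Norms.Operator
open NormedSpace

theorem hasDerivAt_exp_smul_mulVec (A : Mat n) (v : Vec n) (t : ℝ) :
    HasDerivAt (fun s : ℝ => exp (s • A) *ᵥ v) (A *ᵥ (exp (t • A) *ᵥ v)) t := by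
  have h := hasDerivAt_exp_smul_const' (𝕂 := ℝ) A t
  let L : Mat n →L[ℝ] Vec n := LinearMap.toContinuousLinearMap
    { toFun := fun M => M *ᵥ v
      map_add' := fun M N => Matrix.add_mulVec M N v
      map_smul' := fun c M => Matrix.smul_mulVec c M v }
  have h2 := L.hasFDerivAt.comp_hasDerivAt t h
  rw [Matrix.mulVec_mulVec]
  exact h2

/-- Uniqueness for the linear equation y' = Ay: the curve exp(-sA) y(s) has zero derivative. The
explicit exponentials below follow by exhibiting the solution. -/
theorem eq_exp_smul_mulVec {A : Mat n} {y : ℝ → Vec n} (hy : ∀ t, HasDerivAt y (A *ᵥ y t) t)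
    (t : ℝ) : exp (t • A) *ᵥ y 0 = y t := by
  let L : Mat n →L[ℝ] Vec n →L[ℝ] Vec n := LinearMap.toContinuousLinearMap
    { toFun := fun M => LinearMap.toContinuousLinearMap M.mulVecLin
      map_add' := fun M N => by ext v; simp
      map_smul' := fun c M => by ext v; simp }
  have hd : ∀ s : ℝ, HasDerivAt (fun s : ℝ => exp (s • -A) *ᵥ y s) 0 s := by
    intro s
    have h := hasDerivAt_exp_smul_const (𝕂 := ℝ) (-A) s
    have h2 := (L.hasFDerivAt.comp_hasDerivAt s h).clm_apply (hy s)
    convert! h2 using 1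
    change 0 = (exp (s • -A) * -A) *ᵥ y s + exp (s • -A) *ᵥ (A *ᵥ y s)
    rw [mul_neg, Matrix.neg_mulVec, ← Matrix.mulVec_mulVec, neg_add_cancel]
  have hc := is_const_of_deriv_eq_zero (fun s => (hd s).differentiableAt)
    (fun s => (hd s).deriv) t 0
  simp only [zero_smul, exp_zero, Matrix.one_mulVec] at hc
  rw [← hc, Matrix.mulVec_mulVec, ← Matrix.exp_add_of_commute]
  · simp
  · rw [smul_neg]; exact (Commute.refl _).neg_right

theorem exp_mulVec_of_mulVec_eq_zero {A : Mat n} {v : Vec n} (h : A *ᵥ v = 0) :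
    exp A *ᵥ v = v := by
  have := eq_exp_smul_mulVec (A := A) (y := fun _ => v)
    (fun t => by simpa [h] using hasDerivAt_const t v) 1
  simpa using this

theorem exp_mulVec_of_mulVec_eq_smul {A : Mat n} {v : Vec n} {c : ℝ} (h : A *ᵥ v = c • v) :
    exp A *ᵥ v = Real.exp c • v := by
  have := eq_exp_smul_mulVec (A := A) (y := fun t => Real.exp (t * c) • v)
    (fun t => by
      have h1 := (((hasDerivAt_id t).mul_const c).exp).smul_const v
      convert! h1 using 1
      simp [Matrix.mulVec_smul, h, smul_smul]) 1
  simpa using this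

theorem exp_smul_mulVec_rotation {A : Mat n} {v w : Vec n} (h1 : A *ᵥ v = w) (h2 : A *ᵥ w = -v)
    (t : ℝ) : exp (t • A) *ᵥ v = Real.cos t • v + Real.sin t • w := by
  have := eq_exp_smul_mulVec (A := A) (y := fun t => Real.cos t • v + Real.sin t • w)
    (fun t => by
      convert! ((Real.hasDerivAt_cos t).smul_const v).add
        ((Real.hasDerivAt_sin t).smul_const w) using 1
      rw [Matrix.mulVec_add, Matrix.mulVec_smul, Matrix.mulVec_smul, h1, h2]
      module) t
  simpa using this

theorem exp_smul_mulVec_boost {A : Mat n} {v w : Vec n} (h1 : A *ᵥ v = w) (h2 : A *ᵥ w = v)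
    (t : ℝ) : exp (t • A) *ᵥ v = Real.cosh t • v + Real.sinh t • w := by
  have := eq_exp_smul_mulVec (A := A) (y := fun t => Real.cosh t • v + Real.sinh t • w)
    (fun t => by
      convert! ((Real.hasDerivAt_cosh t).smul_const v).add
        ((Real.hasDerivAt_sinh t).smul_const w) using 1
      rw [Matrix.mulVec_add, Matrix.mulVec_smul, Matrix.mulVec_smul, h1, h2]
      module) t
  simpa using this

theorem g_exp_mulVec {X : Mat n} (hX : X ∈ so n) (u v : Vec n) :
    g n (exp X *ᵥ u) (exp X *ᵥ v) = g n u v := by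
  let B : Vec n →L[ℝ] Vec n →L[ℝ] ℝ := LinearMap.toContinuousLinearMap
    { toFun := fun u => LinearMap.toContinuousLinearMap (g n u)
      map_add' := fun u v => by ext w; simp
      map_smul' := fun c u => by ext w; simp }
  have hB : ∀ u v, B u v = g n u v := fun u v => rfl
  have hd : ∀ s : ℝ, HasDerivAt (fun s : ℝ => g n (exp (s • X) *ᵥ u) (exp (s • X) *ᵥ v)) 0 s := by
    intro s
    have h := (B.hasFDerivAt.comp_hasDerivAt s (hasDerivAt_exp_smul_mulVec X u s)).clm_apply
      (hasDerivAt_exp_smul_mulVec X v s)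
    convert! h using 1
    simp only [Function.comp, hB]
    rw [so_skew hX, neg_add_cancel]
  have hc := is_const_of_deriv_eq_zero (fun s => (hd s).differentiableAt)
    (fun s => (hd s).deriv) 1 0
  simpa using hc

theorem mem_so_of_g_exp_mulVec {X : Mat n}
    (h : ∀ (t : ℝ) (u v : Vec n), g n (exp (t • X) *ᵥ u) (exp (t • X) *ᵥ v) = g n u v) :
    X ∈ so n := by
  let B : Vec n →L[ℝ] Vec n →L[ℝ] ℝ := LinearMap.toContinuousLinearMap
    { toFun := fun u => LinearMap.toContinuousLinearMap (g n u)
      map_add' := fun u v => by ext w; simp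
      map_smul' := fun c u => by ext w; simp }
  have hB : ∀ u v, B u v = g n u v := fun u v => rfl
  rw [mem_so]
  intro u v
  have h1 := (B.hasFDerivAt.comp_hasDerivAt 0 (hasDerivAt_exp_smul_mulVec X u 0)).clm_apply
      (hasDerivAt_exp_smul_mulVec X v 0)
  have h2 : HasDerivAt (fun s : ℝ => g n (exp (s • X) *ᵥ u) (exp (s • X) *ᵥ v)) 0 0 := by
    simp only [h]
    exact hasDerivAt_const _ _
  have h3 := h1.unique h2
  simp only [Function.comp, hB, zero_smul, exp_zero, Matrix.one_mulVec] at h3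
  linarith

/-- The exponential is the square of exp(X/2). Positivity selects the sign in `det_exp_of_mem_so`,
where isometry alone gives determinant ±1. -/
theorem det_exp_pos (X : Mat n) : 0 < (exp X).det := by
  have h : exp X = exp ((1 / 2 : ℝ) • X) * exp ((1 / 2 : ℝ) • X) := by
    rw [← Matrix.exp_add_of_commute _ _ (Commute.refl _), ← add_smul]
    norm_num
  have hu : IsUnit (exp X).det := (Matrix.isUnit_iff_isUnit_det _).1 (Matrix.isUnit_exp X)
  refine lt_of_le_of_ne ?_ hu.ne_zero.symm
  rw [h, Matrix.det_mul]
  exact mul_self_nonneg _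

theorem det_exp_of_mem_so {X : Mat n} (hX : X ∈ so n) : (exp X).det = 1 := by
  have h : (exp X)ᵀ * gram n * exp X = gram n := by
    refine mat_ext fun v => eq_of_g_eq fun u => ?_
    rw [← gram_mulVec_gram_mulVec u, g_gram_left, g_gram_left, ← Matrix.mulVec_mulVec,
      ← Matrix.mulVec_mulVec, Matrix.dotProduct_mulVec, Matrix.vecMul_transpose,
      ← g_eq_dotProduct, ← g_eq_dotProduct, g_exp_mulVec hX]
  have hd := congrArg Matrix.det h
  rw [Matrix.det_mul, Matrix.det_mul, Matrix.det_transpose] at hd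
  have hg : (gram n).det ≠ 0 := by
    have := congrArg Matrix.det (gram_mul_gram n)
    rw [Matrix.det_mul, Matrix.det_one] at this
    intro h0; rw [h0] at this; simp at this
  have hsq : (exp X).det * (exp X).det = 1 := by
    apply mul_right_cancel₀ hg; linarith
  nlinarith [det_exp_pos X]

theorem exp_mulVec_mem {X : Mat n} {U : Submodule ℝ (Vec n)} (h : ∀ u ∈ U, X *ᵥ u ∈ U) {u : Vec n}
    (hu : u ∈ U) : exp X *ᵥ u ∈ U := by
  have hs := NormedSpace.exp_series_hasSum_exp' (𝕂 := ℝ) X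
  let L : Mat n →L[ℝ] Vec n := LinearMap.toContinuousLinearMap
    { toFun := fun M => M *ᵥ u
      map_add' := fun M N => Matrix.add_mulVec M N u
      map_smul' := fun c M => Matrix.smul_mulVec c M u }
  have h2 := L.hasSum hs
  have hpow : ∀ k : ℕ, X ^ k *ᵥ u ∈ U := by
    intro k
    induction k with
    | zero => simpa using hu
    | succ k ih => rw [pow_succ', ← Matrix.mulVec_mulVec]; exact h _ ih
  refine U.closed_of_finiteDimensional.mem_of_tendsto h2 (Filter.Eventually.of_forall fun s => ?_)
  refine Submodule.sum_mem _ fun k _ => ?_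
  change ((k.factorial : ℝ)⁻¹ • X ^ k) *ᵥ u ∈ U
  rw [Matrix.smul_mulVec]
  exact U.smul_mem _ (hpow k)

theorem mulVec_mem_of_exp {X : Mat n} {U : Submodule ℝ (Vec n)} {u : Vec n}
    (h : ∀ t : ℝ, exp (t • X) *ᵥ u ∈ U) : X *ᵥ u ∈ U := by
  have hd := hasDerivAt_exp_smul_mulVec X u 0
  rw [hasDerivAt_iff_tendsto_slope] at hd
  simp only [zero_smul, exp_zero, Matrix.one_mulVec] at hd
  refine U.closed_of_finiteDimensional.mem_of_tendsto hd (Filter.Eventually.of_forall fun t => ?_)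
  rw [slope_def_module]
  exact U.smul_mem _ (U.sub_mem (h _) (h _))

end Exponential

/-- The exponential of a matrix, as an element of `GL(V)`. -/
noncomputable def expGL (X : Mat n) : GL (Fin (n + 2)) ℝ :=
  Matrix.GeneralLinearGroup.mkOfDetNeZero (NormedSpace.exp X) (det_exp_pos X).ne'

theorem coe_expGL (X : Mat n) : (expGL X : Mat n) = NormedSpace.exp X := rfl

theorem expGL_mem_lieSubgroup {h : LieSubalgebra ℝ (Mat n)} {X : Mat n} (hX : X ∈ h) :
    expGL X ∈ lieSubgroup h :=
  Subgroup.subset_closure ⟨X, hX, rfl⟩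

theorem eq_expGL {a : GL (Fin (n + 2)) ℝ} {X : Mat n} (h : (a : Mat n) = NormedSpace.exp X) :
    a = expGL X := Units.ext h

theorem lieSubgroup_le_iff {h : LieSubalgebra ℝ (Mat n)} {K : Subgroup (GL (Fin (n + 2)) ℝ)} :
    lieSubgroup h ≤ K ↔ ∀ X ∈ h, expGL X ∈ K := by
  rw [lieSubgroup, Subgroup.closure_le]
  refine ⟨fun H X hX => H ⟨X, hX, rfl⟩, ?_⟩
  rintro H a ⟨X, hX, ha⟩
  rw [eq_expGL ha]
  exact H X hX

theorem lieSubgroup_mono {h k : LieSubalgebra ℝ (Mat n)} (hk : h ≤ k) :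
    lieSubgroup h ≤ lieSubgroup k :=
  lieSubgroup_le_iff.2 fun _ hX => expGL_mem_lieSubgroup (hk hX)

theorem lieSubgroup_le_SO {h : LieSubalgebra ℝ (Mat n)} {W : Submodule ℝ (Vec n)}
    (hW : h ≤ soSub W) : lieSubgroup h ≤ SO W :=
  lieSubgroup_le_iff.2 fun _ hX => ⟨g_exp_mulVec (hW hX).1, det_exp_of_mem_so (hW hX).1,
    fun v hv => exp_mulVec_of_mulVec_eq_zero ((hW hX).2 v hv)⟩

theorem g_mulVec_of_mem_SO0 {a : GL (Fin (n + 2)) ℝ} (ha : a ∈ SO0 n) (u v : Vec n) :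
    g n ((a : Mat n) *ᵥ u) ((a : Mat n) *ᵥ v) = g n u v := by
  have h : SO0 n ≤ SO ⊤ := lieSubgroup_le_SO fun X hX => ⟨hX, fun v hv => by
    rw [eq_zero_of_g_eq_zero fun u => hv u trivial, Matrix.mulVec_zero]⟩
  exact (h ha).1 u v

/-! ### Transitivity of the connected Lorentz group -/

/-- A boost in the plane of `u` and `v`. The sign is unavoidable, since the connected group
preserves each half of the timelike cone. -/
theorem exists_SO0_timelike {u v : Vec n} (hu : g n u u = -1) (hv : g n v v = -1) :
    ∃ a ∈ SO0 n, (a : Mat n) *ᵥ u = v ∨ (a : Mat n) *ᵥ u = -v := by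
  wlog hneg : g n u v ≤ 0 generalizing v
  · obtain ⟨a, ha, h⟩ := this (v := -v) (by simpa using hv) (by simp at hneg ⊢; linarith)
    exact ⟨a, ha, by rw [neg_neg] at h; exact h.symm⟩
  set w' := v + g n u v • u with hw'
  have hort : g n u w' = 0 := by simp [hw', hu]
  have hself : g n w' w' = g n u v ^ 2 - 1 := by
    simp only [hw', map_add, map_smul, LinearMap.add_apply, LinearMap.smul_apply, smul_eq_mul, hu,
      hv, g_comm v u]
    ring
  have hvw : v = (-g n u v) • u + w' := by rw [hw']; module
  by_cases h0 : w' = 0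
  · have hc : g n u v = -1 := by
      rw [h0] at hself
      simp at hself
      nlinarith
    refine ⟨1, one_mem _, Or.inl ?_⟩
    rw [hvw, h0, hc]; simp
  have hpos := g_self_pos_of_orth (by linarith) hort h0
  set s := Real.sqrt (g n w' w') with hs
  have hs0 : 0 < s := Real.sqrt_pos.2 hpos
  have hs2 : s * s = g n w' w' := Real.mul_self_sqrt hpos.le
  set w := s⁻¹ • w' with hw
  have huw : g n u w = 0 := by rw [hw, map_smul, hort, smul_zero]
  have hww : g n w w = 1 := by
    rw [hw]; simp only [map_smul, LinearMap.smul_apply, smul_eq_mul, ← hs2]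
    field_simp
  -- The rapidity is arsinh s, because v = -g(u,v) u + s w with g(u,v)² = 1 + s².
  refine ⟨expGL (Real.arsinh s • wedge u w),
    expGL_mem_lieSubgroup ((so n).smul_mem _ (wedge_mem_so u w)), Or.inl ?_⟩
  rw [coe_expGL, exp_smul_mulVec_boost (w := w), Real.sinh_arsinh, Real.cosh_arsinh]
  · have : Real.sqrt (1 + s ^ 2) = -g n u v := by
      rw [Real.sqrt_eq_iff_mul_self_eq (by positivity) (by linarith)]
      nlinarith
    rw [this, hw, smul_smul, mul_inv_cancel₀ hs0.ne', one_smul, ← hvw]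
  · rw [wedge_mulVec, hu, g_comm, huw]; simp
  · rw [wedge_mulVec, hww, huw]; simp

/-- A rotation in the plane of `v` and `w`, which is orthogonal to `u`. The sign is allowed because
for n = 0 the complement of `u` is a line, and `-v` cannot be reached from `v` while fixing `u`. -/
theorem exists_SO0_spacelike {u v w : Vec n} (hu : g n u u < 0) (huv : g n u v = 0)
    (huw : g n u w = 0) (hv : g n v v = 1) (hw : g n w w = 1) :
    ∃ a ∈ SO0 n, (a : Mat n) *ᵥ u = u ∧
      ((a : Mat n) *ᵥ v = w ∨ (a : Mat n) *ᵥ v = -w) := by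
  set c := g n v w with hc
  set z' := w - c • v with hz'
  have huz : g n u z' = 0 := by rw [hz', map_sub, map_smul, huw, huv]; simp
  have hvz : g n v z' = 0 := by simp [hz', hv, hc]
  have hself : g n z' z' = 1 - c ^ 2 := by
    simp only [hz', map_sub, map_smul, LinearMap.sub_apply, LinearMap.smul_apply, smul_eq_mul, hw,
      hv, g_comm w v, ← hc]
    ring
  have hwz : w = c • v + z' := by rw [hz']; module
  by_cases h0 : z' = 0
  · refine ⟨1, one_mem _, by simp, ?_⟩
    rw [h0] at hself
    have hcc : (c - 1) * (c + 1) = 0 := by simp at hself; linarith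
    rw [h0, add_zero] at hwz
    rcases mul_eq_zero.1 hcc with h | h
    · left; rw [hwz, sub_eq_zero.1 h]; simp
    · right; rw [hwz, eq_neg_of_add_eq_zero_left h]; simp
  have hpos := g_self_pos_of_orth hu huz h0
  set s := Real.sqrt (g n z' z') with hs
  have hs0 : 0 < s := Real.sqrt_pos.2 hpos
  have hs2 : s * s = g n z' z' := Real.mul_self_sqrt hpos.le
  set z := s⁻¹ • z' with hz
  have hvz1 : g n v z = 0 := by rw [hz, map_smul, hvz, smul_zero]
  have huz1 : g n u z = 0 := by rw [hz, map_smul, huz, smul_zero]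
  have hzz : g n z z = 1 := by
    rw [hz]; simp only [map_smul, LinearMap.smul_apply, smul_eq_mul, ← hs2]
    field_simp
  refine ⟨expGL (Real.arccos c • wedge z v),
    expGL_mem_lieSubgroup ((so n).smul_mem _ (wedge_mem_so z v)), ?_, Or.inl ?_⟩
  · apply exp_mulVec_of_mulVec_eq_zero
    rw [Matrix.smul_mulVec, wedge_mulVec, g_comm, huv, g_comm z, huz1]; simp
  · rw [coe_expGL, exp_smul_mulVec_rotation (w := z), Real.sin_arccos,
      Real.cos_arccos (by nlinarith) (by nlinarith), ← hself, ← hs, hz, smul_smul,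
      mul_inv_cancel₀ hs0.ne', one_smul, ← hwz]
    · rw [wedge_mulVec, hv, g_comm, hvz1]; simp
    · rw [wedge_mulVec, hzz, hvz1]; simp

theorem IsWittPair.symm {p q : Vec n} (h : IsWittPair p q) : IsWittPair q p :=
  ⟨h.right, h.left, by rw [g_comm, h.pair]⟩

theorem IsWittPair.pair' {p q : Vec n} (h : IsWittPair p q) : g n q p = 1 := h.symm.pair

/-- A Witt pair amounts to the orthonormal vectors (p - q)/√2, timelike, and (p + q)/√2, spacelike;
these are moved one after the other. The two sign ambiguities produce the four endings: equal signs
keep the order of `p` and `q`, opposite signs exchange them. -/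
theorem exists_SO0_wittPair {p q p' q' : Vec n} (h : IsWittPair p q) (h' : IsWittPair p' q') :
    ∃ a ∈ SO0 n, ∃ c : ℝ, c ≠ 0 ∧
      (((a : Mat n) *ᵥ p' = c • p ∧ (a : Mat n) *ᵥ q' = c⁻¹ • q) ∨
        ((a : Mat n) *ᵥ p' = c • q ∧ (a : Mat n) *ᵥ q' = c⁻¹ • p)) := by
  set r := (Real.sqrt 2)⁻¹ with hr
  have hr2 : r * r = 1 / 2 := by
    rw [hr, ← mul_inv, Real.mul_self_sqrt (by norm_num)]; norm_num
  have hr0 : r ≠ 0 := by intro h0; rw [h0] at hr2; norm_num at hr2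
  have norms : ∀ {p q : Vec n}, IsWittPair p q → g n (r • (p - q)) (r • (p - q)) = -1 ∧
      g n (r • (p + q)) (r • (p + q)) = 1 ∧ g n (r • (p - q)) (r • (p + q)) = 0 := by
    intro p q h
    simp only [map_add, map_sub, map_smul, LinearMap.add_apply, LinearMap.sub_apply,
      LinearMap.smul_apply, smul_eq_mul, h.left, h.right, h.pair, h.pair']
    refine ⟨?_, ?_, ?_⟩ <;> linarith
  obtain ⟨h1, h2, h3⟩ := norms h
  obtain ⟨h1', h2', h3'⟩ := norms h'
  obtain ⟨a, ha, hau⟩ := exists_SO0_timelike h1' h1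
  have e3 : g n (r • (p - q)) ((a : Mat n) *ᵥ (r • (p' + q'))) = 0 := by
    have := g_mulVec_of_mem_SO0 ha (r • (p' - q')) (r • (p' + q'))
    rw [h3'] at this
    rcases hau with hau | hau <;> rw [hau] at this
    · exact this
    · simpa using this
  obtain ⟨b, hb, hbu, hbv⟩ := exists_SO0_spacelike (by linarith) e3 h3
    (by rw [g_mulVec_of_mem_SO0 ha, h2']) h2
  refine ⟨b * a, mul_mem hb ha, ?_⟩
  have eu : ((b * a : GL (Fin (n + 2)) ℝ) : Mat n) *ᵥ (p' - q') = p - q ∨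
      ((b * a : GL (Fin (n + 2)) ℝ) : Mat n) *ᵥ (p' - q') = -(p - q) := by
    rw [Units.val_mul, ← Matrix.mulVec_mulVec]
    rcases hau with hau | hau
    · left
      apply smul_right_injective _ hr0
      simp only
      rw [← Matrix.mulVec_smul, ← Matrix.mulVec_smul, hau, hbu]
    · right
      apply smul_right_injective _ hr0
      simp only
      rw [← Matrix.mulVec_smul, ← Matrix.mulVec_smul, hau, Matrix.mulVec_neg, hbu, smul_neg]
  have ev : ((b * a : GL (Fin (n + 2)) ℝ) : Mat n) *ᵥ (p' + q') = p + q ∨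
      ((b * a : GL (Fin (n + 2)) ℝ) : Mat n) *ᵥ (p' + q') = -(p + q) := by
    rw [Units.val_mul, ← Matrix.mulVec_mulVec]
    rcases hbv with hbv | hbv
    · left
      apply smul_right_injective _ hr0
      simp only
      rw [← Matrix.mulVec_smul, ← Matrix.mulVec_smul, hbv]
    · right
      apply smul_right_injective _ hr0
      simp only
      rw [← Matrix.mulVec_smul, ← Matrix.mulVec_smul, hbv, smul_neg]
  set M := ((b * a : GL (Fin (n + 2)) ℝ) : Mat n)
  have ep : M *ᵥ p' = (1 / 2 : ℝ) • (M *ᵥ (p' + q') + M *ᵥ (p' - q')) := by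
    rw [← Matrix.mulVec_add, ← Matrix.mulVec_smul]; congr 1; module
  have eq : M *ᵥ q' = (1 / 2 : ℝ) • (M *ᵥ (p' + q') - M *ᵥ (p' - q')) := by
    rw [← Matrix.mulVec_sub, ← Matrix.mulVec_smul]; congr 1; module
  rw [ep, eq]
  rcases eu with eu | eu <;> rcases ev with ev | ev <;> rw [eu, ev]
  · exact ⟨1, one_ne_zero, Or.inl ⟨by module, by simp; module⟩⟩
  · exact ⟨-1, by norm_num, Or.inr ⟨by module, by rw [inv_neg, inv_one]; module⟩⟩
  · exact ⟨1, one_ne_zero, Or.inr ⟨by module, by simp; module⟩⟩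
  · exact ⟨-1, by norm_num, Or.inl ⟨by module, by rw [inv_neg, inv_one]; module⟩⟩

/-! ### Conjugation -/

theorem coe_inv_mulVec (a : GL (Fin (n + 2)) ℝ) (v : Vec n) :
    ((a⁻¹ : GL (Fin (n + 2)) ℝ) : Mat n) *ᵥ ((a : Mat n) *ᵥ v) = v := by
  rw [Matrix.mulVec_mulVec, ← Units.val_mul, inv_mul_cancel, Units.val_one, Matrix.one_mulVec]

theorem coe_mulVec_inv (a : GL (Fin (n + 2)) ℝ) (v : Vec n) :
    (a : Mat n) *ᵥ (((a⁻¹ : GL (Fin (n + 2)) ℝ) : Mat n) *ᵥ v) = v := by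
  rw [Matrix.mulVec_mulVec, ← Units.val_mul, mul_inv_cancel, Units.val_one, Matrix.one_mulVec]

theorem conj_mulVec (a : GL (Fin (n + 2)) ℝ) (X : Mat n) (v : Vec n) :
    (a.1 * X * (a⁻¹).1) *ᵥ ((a : Mat n) *ᵥ v) = (a : Mat n) *ᵥ (X *ᵥ v) := by
  rw [← Matrix.mulVec_mulVec, ← Matrix.mulVec_mulVec, coe_inv_mulVec]

theorem conj_mulVec_eq (a : GL (Fin (n + 2)) ℝ) {X : Mat n} {u v : Vec n} {b d : ℝ}
    (hb : b ≠ 0) (hv : (a : Mat n) *ᵥ u = b • v) (hu : X *ᵥ u = d • u) :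
    (a.1 * X * (a⁻¹).1) *ᵥ v = d • v := by
  have h : v = b⁻¹ • ((a : Mat n) *ᵥ u) := by
    rw [hv, smul_smul, inv_mul_cancel₀ hb, one_smul]
  rw [h, Matrix.mulVec_smul, conj_mulVec, hu, Matrix.mulVec_smul, smul_comm]

theorem coe_mulVec_ne_zero (a : GL (Fin (n + 2)) ℝ) {v : Vec n} (hv : v ≠ 0) :
    (a : Mat n) *ᵥ v ≠ 0 := fun h => hv (by rw [← coe_inv_mulVec a v, h, Matrix.mulVec_zero])

theorem conj_mem_so {a : GL (Fin (n + 2)) ℝ} (ha : a ∈ SO0 n) {X : Mat n} (hX : X ∈ so n) :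
    a.1 * X * (a⁻¹).1 ∈ so n := by
  rw [mem_so]
  intro u v
  rw [← coe_mulVec_inv a u, ← coe_mulVec_inv a v, conj_mulVec, conj_mulVec,
    g_mulVec_of_mem_SO0 ha, g_mulVec_of_mem_SO0 ha, so_skew hX]

theorem conj_le_so {a : GL (Fin (n + 2)) ℝ} (ha : a ∈ SO0 n) {h : LieSubalgebra ℝ (Mat n)}
    (hh : h ≤ so n) : conj a h ≤ so n := by
  rintro _ ⟨X, hX, rfl⟩
  exact conj_mem_so ha (hh hX)

theorem conj_mul (a : GL (Fin (n + 2)) ℝ) (P Q : Mat n) :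
    (a.1 * P * (a⁻¹).1) * (a.1 * Q * (a⁻¹).1) = a.1 * (P * Q) * (a⁻¹).1 := by
  have e : (a⁻¹).1 * a.1 = 1 := by rw [← Units.val_mul, inv_mul_cancel, Units.val_one]
  rw [show (a.1 * P * (a⁻¹).1) * (a.1 * Q * (a⁻¹).1) =
    a.1 * P * ((a⁻¹).1 * a.1) * Q * (a⁻¹).1 by noncomm_ring, e]
  noncomm_ring

theorem conj_lie (a : GL (Fin (n + 2)) ℝ) (P Q : Mat n) :
    ⁅a.1 * P * (a⁻¹).1, a.1 * Q * (a⁻¹).1⁆ = a.1 * ⁅P, Q⁆ * (a⁻¹).1 := by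
  rw [Ring.lie_def, Ring.lie_def, conj_mul, conj_mul, mul_sub, sub_mul]

theorem trace_conj_sq (a : GL (Fin (n + 2)) ℝ) (X : Mat n) :
    ((a.1 * X * (a⁻¹).1) * (a.1 * X * (a⁻¹).1)).trace = (X * X).trace := by
  rw [conj_mul, Matrix.trace_mul_comm, ← mul_assoc, ← Units.val_mul, inv_mul_cancel, Units.val_one,
    one_mul]

/-! ### The trace form on elements without real eigenvalues -/

/-- The endomorphism has a nonzero real eigenvalue. -/
def Hyperbolic (X : Mat n) : Prop := ∃ v : Vec n, v ≠ 0 ∧ ∃ c : ℝ, c ≠ 0 ∧ X *ᵥ v = c • v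

theorem g_single_zero (n : ℕ) : g n (Pi.single 0 1) (Pi.single 0 1) = -1 := by
  rw [g_apply]; simp

/-- A timelike vector can be moved into the time axis. -/
theorem exists_SO0_mulVec_time {v : Vec n} (hv : g n v v < 0) :
    ∃ a ∈ SO0 n, ∃ c : ℝ, c ≠ 0 ∧ (a : Mat n) *ᵥ v = c • Pi.single 0 1 := by
  set s := Real.sqrt (-g n v v) with hs
  have hs0 : 0 < s := Real.sqrt_pos.2 (by linarith)
  have hs2 : s * s = -g n v v := Real.mul_self_sqrt (by linarith)
  have h1 : g n (s⁻¹ • v) (s⁻¹ • v) = -1 := by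
    have : g n v v = -(s * s) := by linarith
    simp only [map_smul, LinearMap.smul_apply, smul_eq_mul, this]
    field_simp
  have h2 : ∀ a : GL (Fin (n + 2)) ℝ, (a : Mat n) *ᵥ v = s • ((a : Mat n) *ᵥ (s⁻¹ • v)) := by
    intro a
    rw [Matrix.mulVec_smul, smul_smul, mul_inv_cancel₀ hs0.ne', one_smul]
  obtain ⟨a, ha, h | h⟩ := exists_SO0_timelike h1 (g_single_zero n)
  · exact ⟨a, ha, s, hs0.ne', by rw [h2, h]⟩
  · exact ⟨a, ha, -s, neg_ne_zero.2 hs0.ne', by rw [h2, h]; module⟩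

/-- With `v` moved to the time axis, `X` becomes a skew-symmetric matrix, and tr X² is minus the sum
of the squares of its entries. -/
theorem trace_sq_of_mulVec_timelike {X : Mat n} (hX : X ∈ so n) {v : Vec n} (hv : g n v v < 0)
    (h : X *ᵥ v = 0) : (X * X).trace ≤ 0 ∧ ((X * X).trace = 0 → X = 0) := by
  obtain ⟨a, ha, c, hc, hav⟩ := exists_SO0_mulVec_time hv
  set Y := a.1 * X * (a⁻¹).1 with hY
  have hYt : Yᵀ = -Y := by
    apply transpose_eq_neg_of_mulVec_time (conj_mem_so ha hX) hc
    rw [← hav, conj_mulVec, h, Matrix.mulVec_zero]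
  have htr : (X * X).trace = -∑ i, ∑ j, Y i j * Y i j := by
    rw [← trace_conj_sq a, ← hY]
    have : Y * Y = -(Y * Yᵀ) := by rw [hYt, mul_neg, neg_neg]
    rw [this, Matrix.trace_neg]
    rfl
  have hnn : ∀ i, 0 ≤ ∑ j, Y i j * Y i j := fun i => Finset.sum_nonneg fun j _ => mul_self_nonneg _
  refine ⟨by rw [htr]; exact neg_nonpos.2 (Finset.sum_nonneg fun i _ => hnn i), fun h0 => ?_⟩
  rw [htr, neg_eq_zero, Finset.sum_eq_zero_iff_of_nonneg fun i _ => hnn i] at h0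
  have hY0 : Y = 0 := by
    ext i j
    have := h0 i (Finset.mem_univ _)
    rw [Finset.sum_eq_zero_iff_of_nonneg fun j _ => mul_self_nonneg _] at this
    exact mul_self_eq_zero.1 (this j (Finset.mem_univ _))
  refine mat_ext fun u => ?_
  have := conj_mulVec a X u
  rw [← hY, hY0, Matrix.zero_mulVec] at this
  rw [← coe_inv_mulVec a (X *ᵥ u), ← this, Matrix.mulVec_zero, Matrix.zero_mulVec]

/-- The time reflection of `p` is again null, and it pairs with `p` to the Euclidean square of `p`.
-/
theorem exists_wittPair {p : Vec n} (hp : p ≠ 0) (h : g n p p = 0) : ∃ q, IsWittPair p q := by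
  have hpp : p ⬝ᵥ p ≠ 0 := fun h0 => hp (dotProduct_self_eq_zero.1 h0)
  refine ⟨(p ⬝ᵥ p)⁻¹ • (gram n *ᵥ p), h, ?_, ?_⟩
  · rw [map_smul, map_smul, LinearMap.smul_apply, g_gram_left, ← g_eq_dotProduct, h]
    simp
  · rw [map_smul, g_comm, g_gram_left, smul_eq_mul, inv_mul_cancel₀ hpp]

theorem IsWittPair.g_sub {p q : Vec n} (h : IsWittPair p q) : g n (p - q) (p - q) = -2 := by
  simp only [map_sub, LinearMap.sub_apply, h.left, h.right, h.pair, h.pair']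
  norm_num

theorem IsWittPair.left_ne_zero {p q : Vec n} (h : IsWittPair p q) : p ≠ 0 := by
  rintro rfl
  simpa using h.pair

/-- For null `v`, complete it to a Witt pair and write X = X' + v∧x, where X' also kills `q` and `x`
is orthogonal to both. The bivector contributes nothing to tr X², so the timelike case applies to X'
at v - q; if the trace vanishes, X = v∧x, whose cube is zero. -/
theorem trace_sq_of_mulVec_causal {X : Mat n} (hX : X ∈ so n) {v : Vec n} (hv0 : v ≠ 0)
    (hv : g n v v ≤ 0) (h : X *ᵥ v = 0) :
    (X * X).trace ≤ 0 ∧ ((X * X).trace = 0 → IsNilpotent X) := by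
  rcases hv.lt_or_eq with hv | hv
  · obtain ⟨h1, h2⟩ := trace_sq_of_mulVec_timelike hX hv h
    exact ⟨h1, fun h0 => by rw [h2 h0]; exact IsNilpotent.zero⟩
  obtain ⟨q, hq⟩ := exists_wittPair hv0 hv
  set x := -(X *ᵥ q) with hx
  have hvx : g n v x = 0 := by
    rw [hx, map_neg, ← so_skew hX, h]; simp
  have hqx : g n q x = 0 := by rw [hx, map_neg, so_self hX, neg_zero]
  have hwv : wedge v x *ᵥ v = 0 := by rw [wedge_mulVec, g_comm, hvx, hv]; simp
  have hwq : wedge v x *ᵥ q = -x := by rw [wedge_mulVec, g_comm, hqx, hq.pair]; simp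
  set X' := X - wedge v x with hX'
  have hX's : X' ∈ so n := sub_mem hX (wedge_mem_so _ _)
  have h1 : X' *ᵥ v = 0 := by rw [hX', Matrix.sub_mulVec, h, hwv, sub_zero]
  have h2 : X' *ᵥ q = 0 := by rw [hX', Matrix.sub_mulVec, hwq, hx]; simp
  have hdec : X = X' + wedge v x := by rw [hX']; abel
  have htr : (X * X).trace = (X' * X').trace := by
    have e1 : (X' * wedge v x).trace = 0 := by
      rw [trace_mul_wedge, g_comm v, so_skew hX's, h1]; simp
    have e2 : (wedge v x * wedge v x).trace = 0 := by
      rw [trace_mul_wedge, g_comm v, so_skew (wedge_mem_so v x), hwv]; simp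
    rw [hdec, add_mul, mul_add, mul_add, Matrix.trace_add, Matrix.trace_add, Matrix.trace_add,
      Matrix.trace_mul_comm (wedge v x) X', e1, e2]
    ring
  obtain ⟨h3, h4⟩ := trace_sq_of_mulVec_timelike hX's (v := v - q) (by rw [hq.g_sub]; norm_num)
    (by rw [Matrix.mulVec_sub, h1, h2, sub_zero])
  refine ⟨htr ▸ h3, fun h0 => ⟨3, ?_⟩⟩
  have hXw : X = wedge v x := by rw [hdec, h4 (htr ▸ h0), zero_add]
  refine mat_ext fun z => ?_
  rw [pow_succ', pow_two, ← Matrix.mulVec_mulVec, ← Matrix.mulVec_mulVec, hXw,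
    wedge_mulVec v x z, Matrix.mulVec_sub, Matrix.mulVec_smul, Matrix.mulVec_smul, hwv,
    wedge_mulVec v x x, hvx, Matrix.mulVec_sub, Matrix.mulVec_smul, Matrix.mulVec_smul,
    Matrix.mulVec_sub, Matrix.mulVec_smul, hwv]
  simp

/-! ### A variational principle on the causal cone -/

theorem sum_g_mulVec {ι : Type*} [Fintype ι] {A : ι → Mat n} (hA : ∀ i, A i ∈ so n)
    (u v : Vec n) : ∑ i, g n (A i *ᵥ u) (A i *ᵥ v) = -g n u ((∑ i, A i * A i) *ᵥ v) := by
  rw [Matrix.sum_mulVec, map_sum, ← Finset.sum_neg_distrib]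
  exact Finset.sum_congr rfl fun i _ => by rw [so_skew (hA i), Matrix.mulVec_mulVec]

theorem continuous_g_self {f : Vec n → Vec n} (hf : Continuous f) :
    Continuous fun v => g n (f v) (f v) := by
  simp only [g_apply]
  fun_prop

/-- For causal `v` each Aᵢv is orthogonal to `v`, so f(v) = ∑ g(Aᵢv, Aᵢv) ≥ 0, and f(v) = 0 makes
`v` a common eigenvector. If f > 0 on the whole cone, -g(v,v)/f(v) is continuous up to the null
boundary and attains a maximum by compactness; the critical point equation there is the eigenvector
equation for ∑ Aᵢ². -/
theorem exists_causal_eigenvector {ι : Type*} [Fintype ι] (A : ι → Mat n)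
    (hA : ∀ i, A i ∈ so n) :
    (∃ v : Vec n, v ≠ 0 ∧ g n v v ≤ 0 ∧ ∀ i, ∃ c : ℝ, A i *ᵥ v = c • v) ∨
      ∃ v : Vec n, g n v v < 0 ∧ ∃ c : ℝ, 0 < c ∧ (∑ i, A i * A i) *ᵥ v = c • v := by
  by_contra hcon
  rw [not_or] at hcon
  obtain ⟨hcon, hcon2⟩ := hcon
  apply hcon2
  set C := ∑ i, A i * A i with hC
  set f : Vec n → ℝ := fun v => ∑ i, g n (A i *ᵥ v) (A i *ᵥ v) with hf
  have hfC : ∀ v, f v = -g n v (C *ᵥ v) := fun v => sum_g_mulVec hA v v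
  have hfpos : ∀ v, v ≠ 0 → g n v v ≤ 0 → 0 < f v := by
    intro v hv0 hv
    have hnn : ∀ i, 0 ≤ g n (A i *ᵥ v) (A i *ᵥ v) := fun i =>
      (g_self_nonneg_of_orth hv hv0 (so_self (hA i) v)).1
    refine lt_of_le_of_ne (Finset.sum_nonneg fun i _ => hnn i) fun h0 => hcon ⟨v, hv0, hv, ?_⟩
    intro i
    exact (g_self_nonneg_of_orth hv hv0 (so_self (hA i) v)).2
      ((Finset.sum_eq_zero_iff_of_nonneg fun i _ => hnn i).1 h0.symm i (Finset.mem_univ _))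
  have hfc : Continuous f := continuous_finsetSum _ fun i _ =>
    continuous_g_self (Continuous.matrix_mulVec continuous_const continuous_id)
  have hgc : Continuous fun v : Vec n => g n v v := continuous_g_self continuous_id
  have hK : IsCompact (Metric.sphere (0 : Vec n) 1 ∩ {v | g n v v ≤ 0}) :=
    (isCompact_sphere _ _).inter_right (isClosed_le hgc continuous_const)
  have hmem : ∀ v : Vec n, v ≠ 0 → g n v v ≤ 0 →
      ‖v‖⁻¹ • v ∈ Metric.sphere (0 : Vec n) 1 ∩ {v | g n v v ≤ 0} := by
    intro v hv0 hv
    refine ⟨?_, ?_⟩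
    · rw [mem_sphere_zero_iff_norm, norm_smul, norm_inv, norm_norm,
        inv_mul_cancel₀ (norm_ne_zero_iff.2 hv0)]
    · have : g n (‖v‖⁻¹ • v) (‖v‖⁻¹ • v) = (‖v‖⁻¹) ^ 2 * g n v v := by
        simp only [map_smul, LinearMap.smul_apply, smul_eq_mul]; ring
      simp only [Set.mem_ofPred_eq, this]
      exact mul_nonpos_of_nonneg_of_nonpos (sq_nonneg _) hv
  have he0 : (Pi.single 0 1 : Vec n) ≠ 0 := by simp
  have heg : g n (Pi.single 0 1 : Vec n) (Pi.single 0 1) ≤ 0 := by rw [g_single_zero]; norm_num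
  have hne0 : ∀ v ∈ Metric.sphere (0 : Vec n) 1 ∩ {v | g n v v ≤ 0}, v ≠ 0 := by
    rintro v ⟨hv, -⟩ rfl
    simp at hv
  obtain ⟨v, hvK, hmax⟩ := hK.exists_isMaxOn ⟨_, hmem _ he0 heg⟩
    (f := fun v => -g n v v / f v)
    (hgc.neg.continuousOn.div hfc.continuousOn fun v hv => (hfpos v (hne0 v hv) hv.2).ne')
  have hv0 := hne0 v hvK
  have hfv := hfpos v hv0 hvK.2
  -- Maximality with denominators cleared; homogeneity extends it from the unit sphere to the whole
  -- cone.
  have hscale : ∀ w : Vec n, g n w w ≤ 0 → 0 ≤ -g n v v * f w + g n w w * f v := by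
    intro w hw
    by_cases hw0 : w = 0
    · rw [hw0]; simp [hf]
    have h1 := hmax (hmem w hw0 hw)
    simp only [Set.mem_ofPred_eq] at h1
    have h2 : -g n (‖w‖⁻¹ • w) (‖w‖⁻¹ • w) / f (‖w‖⁻¹ • w) = -g n w w / f w := by
      rw [hfC, hfC]
      simp only [map_smul, Matrix.mulVec_smul, LinearMap.smul_apply, smul_eq_mul]
      have : ‖w‖ ≠ 0 := norm_ne_zero_iff.2 hw0
      field_simp
    rw [h2, div_le_div_iff₀ (hfpos w hw0 hw) hfv] at h1
    linarith
  -- The quotient vanishes on null vectors but is positive on the time axis, so the maximiser is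
  -- timelike and the variations below stay in the cone.
  have hvneg : g n v v < 0 := by
    have h1 := hscale _ heg
    rw [g_single_zero] at h1
    have h2 := hfpos _ he0 heg
    by_contra h3
    nlinarith [hvK.2.antisymm (not_lt.1 h3)]
  have hcrit : ∀ w, g n v v * g n w (C *ᵥ v) + g n w v * f v = 0 := by
    intro w
    have hCs : g n v (C *ᵥ w) = g n w (C *ᵥ v) := by
      have h1 := sum_g_mulVec hA v w
      have h2 := sum_g_mulVec hA w v
      simp only [g_comm (A _ *ᵥ w)] at h2
      linarith
    set γ := -g n v v * f w + g n w w * f v with hγ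
    set β := g n v v * g n w (C *ᵥ v) + g n w v * f v with hβ
    have hexp : ∀ t : ℝ, -g n v v * f (v + t • w) + g n (v + t • w) (v + t • w) * f v =
        t * (2 * β) + t ^ 2 * γ := by
      intro t
      rw [hβ, hγ]
      simp only [hfC, map_add, map_smul, LinearMap.add_apply, LinearMap.smul_apply, smul_eq_mul,
        Matrix.mulVec_add, Matrix.mulVec_smul, hCs, g_comm v w]
      ring
    have hcont : ContinuousAt (fun t : ℝ => g n (v + t • w) (v + t • w)) 0 := by
      simp only [g_apply]
      fun_prop
    have hev : ∀ᶠ t : ℝ in nhds 0, g n (v + t • w) (v + t • w) < 0 :=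
      hcont.eventually_lt continuousAt_const (by simpa using hvneg)
    -- The polynomial vanishes at 0 and is nonnegative nearby, so its linear coefficient is zero.
    have hmin : IsLocalMin (fun t : ℝ => t * (2 * β) + t ^ 2 * γ) 0 := by
      filter_upwards [hev] with t ht
      have := hscale _ ht.le
      rw [hexp] at this
      simpa using this
    have hder : HasDerivAt (fun t : ℝ => t * (2 * β) + t ^ 2 * γ) (2 * β) 0 := by
      convert! ((hasDerivAt_id (0 : ℝ)).mul_const (2 * β)).add
        ((hasDerivAt_pow 2 (0 : ℝ)).mul_const γ) using 1
      simp
    have := hmin.hasDerivAt_eq_zero hder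
    linarith
  refine ⟨v, hvneg, f v / -g n v v, div_pos hfv (by linarith), ?_⟩
  refine eq_of_g_eq fun w => ?_
  rw [map_smul, smul_eq_mul]
  have h1 := hcrit w
  have h2 : g n v v ≠ 0 := hvneg.ne
  field_simp
  linarith

/-- The variational principle for a single matrix. A causal eigenvector must have eigenvalue zero;
the alternative X²v = cv with c > 0 would factor as (X - √c)(X + √c)v = 0 and give the eigenvalue √c
or -√c. -/
theorem exists_mulVec_eq_zero_of_not_hyperbolic {X : Mat n} (hX : X ∈ so n)
    (h : ¬Hyperbolic X) : ∃ v : Vec n, v ≠ 0 ∧ g n v v ≤ 0 ∧ X *ᵥ v = 0 := by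
  rcases exists_causal_eigenvector (fun _ : Unit => X) (fun _ => hX) with
    ⟨v, hv0, hv, hc⟩ | ⟨v, hv, c, hc, he⟩
  · obtain ⟨c, hc⟩ := hc ()
    by_cases h0 : c = 0
    · exact ⟨v, hv0, hv, by rw [hc, h0, zero_smul]⟩
    · exact absurd ⟨v, hv0, c, h0, hc⟩ h
  exfalso
  have hv0 : v ≠ 0 := by rintro rfl; simp at hv
  have hs0 : Real.sqrt c ≠ 0 := (Real.sqrt_pos.2 hc).ne'
  simp only [Finset.univ_unique, Finset.sum_const, Finset.card_singleton, one_smul,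
    ← Matrix.mulVec_mulVec] at he
  by_cases hw : X *ᵥ v + Real.sqrt c • v = 0
  · exact h ⟨v, hv0, -Real.sqrt c, neg_ne_zero.2 hs0, by
      rw [neg_smul]; exact eq_neg_of_add_eq_zero_left hw⟩
  · refine h ⟨_, hw, Real.sqrt c, hs0, ?_⟩
    rw [Matrix.mulVec_add, Matrix.mulVec_smul, he, smul_add, smul_smul,
      Real.mul_self_sqrt hc.le]
    exact add_comm _ _

theorem trace_sq_of_not_hyperbolic {X : Mat n} (hX : X ∈ so n) (h : ¬Hyperbolic X) :
    (X * X).trace ≤ 0 ∧ ((X * X).trace = 0 → IsNilpotent X) := by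
  obtain ⟨v, hv0, hv, h⟩ := exists_mulVec_eq_zero_of_not_hyperbolic hX h
  exact trace_sq_of_mulVec_causal hX hv0 hv h

/-! ### Lie algebras without hyperbolic elements -/

/-- Engel's theorem, for the action of `h` on `U`. -/
theorem exists_forall_mulVec_eq_zero {h : LieSubalgebra ℝ (Mat n)}
    (hnil : ∀ X ∈ h, IsNilpotent X) {U : Submodule ℝ (Vec n)} (hU : U ≠ ⊥)
    (hinv : Invariant (h : Set (Mat n)) U) : ∃ u ∈ U, u ≠ 0 ∧ ∀ X ∈ h, X *ᵥ u = 0 := by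
  let _ : LieRingModule h U :=
    { bracket := fun X u => ⟨X.1 *ᵥ u.1, hinv X.1 X.2 u.1 u.2⟩
      add_lie := fun X Y u => Subtype.ext (Matrix.add_mulVec X.1 Y.1 u.1)
      lie_add := fun X u v => Subtype.ext (Matrix.mulVec_add X.1 u.1 v.1)
      leibniz_lie := fun X Y u => Subtype.ext (by
        change X.1 *ᵥ (Y.1 *ᵥ u.1) = ⁅X.1, Y.1⁆ *ᵥ u.1 + Y.1 *ᵥ (X.1 *ᵥ u.1)
        rw [lie_mulVec]; abel) }
  let _ : LieModule ℝ h U :=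
    { smul_lie := fun c X u => Subtype.ext (Matrix.smul_mulVec c X.1 u.1)
      lie_smul := fun c X u => Subtype.ext (Matrix.mulVec_smul X.1 c u.1) }
  have hcoe : ∀ (X : h) (u : U), ((⁅X, u⁆ : U) : Vec n) = X.1 *ᵥ u.1 := fun _ _ => rfl
  have : LieModule.IsNilpotent h U := by
    rw [LieModule.isNilpotent_iff_forall' (R := ℝ)]
    intro X
    obtain ⟨k, hk⟩ := hnil X.1 X.2
    refine ⟨k, ?_⟩
    have hpow : ∀ (j : ℕ) (u : U), (((LieModule.toEnd ℝ h U X) ^ j) u : Vec n) =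
        X.1 ^ j *ᵥ u.1 := by
      intro j
      induction j with
      | zero => intro u; simp
      | succ j ih =>
        intro u
        rw [pow_succ', Module.End.mul_apply, LieModule.toEnd_apply_apply, hcoe, ih, pow_succ',
          Matrix.mulVec_mulVec]
    ext1 u
    apply Subtype.ext
    rw [hpow, hk, Matrix.zero_mulVec]
    rfl
  have : Nontrivial U := Submodule.nontrivial_iff_ne_bot.2 hU
  obtain ⟨u, hu⟩ := @exists_ne _ (LieModule.nontrivial_max_triv_of_isNilpotent ℝ h U) 0
  refine ⟨u.1.1, u.1.2, fun h0 => hu (Subtype.ext (Subtype.ext h0)), fun X hX => ?_⟩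
  have := (LieModule.mem_maxTrivSubmodule ℝ h U u.1).1 u.2 ⟨X, hX⟩
  exact congrArg Subtype.val this

/-- The radical of the trace form of a Lie algebra of matrices. -/
def traceRadical (h : LieSubalgebra ℝ (Mat n)) : LieSubalgebra ℝ (Mat n) where
  carrier := {X | X ∈ h ∧ ∀ Y ∈ h, (X * Y).trace = 0}
  add_mem' := fun {A B} hA hB => ⟨add_mem hA.1 hB.1, fun Y hY => by
    rw [add_mul, Matrix.trace_add, hA.2 Y hY, hB.2 Y hY, add_zero]⟩
  zero_mem' := ⟨zero_mem _, fun Y _ => by simp⟩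
  smul_mem' := fun c A hA => ⟨h.smul_mem c hA.1, fun Y hY => by
    rw [smul_mul_assoc, Matrix.trace_smul, hA.2 Y hY, smul_zero]⟩
  lie_mem' := fun {A B} hA hB => ⟨h.lie_mem hA.1 hB.1, fun Y hY => by
    rw [trace_lie_mul, hA.2 _ (h.lie_mem hB.1 hY)]⟩

theorem lie_mem_traceRadical {h : LieSubalgebra ℝ (Mat n)} {X Y : Mat n} (hX : X ∈ h)
    (hY : Y ∈ traceRadical h) : ⁅X, Y⁆ ∈ traceRadical h :=
  ⟨h.lie_mem hX hY.1, fun Z hZ => by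
    rw [← lie_skew, neg_mul, Matrix.trace_neg, trace_lie_mul, hY.2 _ (h.lie_mem hX hZ), neg_zero]⟩

/-- The radical is an ideal of nilpotent elements, so its common kernel V₀ is `h`-invariant. By
Engel a nonzero invariant complement of V₀ would itself contain a nonzero vector of V₀; hence V₀ is
everything. -/
theorem traceRadical_eq_zero {h : LieSubalgebra ℝ (Mat n)} (hso : h ≤ so n)
    (hTR : TotallyReducible (h : Set (Mat n))) (hnh : ∀ X ∈ h, ¬Hyperbolic X) {X : Mat n}
    (hX : X ∈ traceRadical h) : X = 0 := by
  have hnil : ∀ X ∈ traceRadical h, IsNilpotent X := fun X hX =>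
    (trace_sq_of_not_hyperbolic (hso hX.1) (hnh X hX.1)).2 (hX.2 X hX.1)
  let V₀ : Submodule ℝ (Vec n) :=
    { carrier := {v | ∀ X ∈ traceRadical h, X *ᵥ v = 0}
      add_mem' := fun {u v} hu hv X hX => by rw [Matrix.mulVec_add, hu X hX, hv X hX, add_zero]
      zero_mem' := fun X _ => Matrix.mulVec_zero X
      smul_mem' := fun c v hv X hX => by rw [Matrix.mulVec_smul, hv X hX, smul_zero] }
  have hinv : Invariant (h : Set (Mat n)) V₀ := by
    intro A hA v hv X hX
    have h1 := lie_mem_traceRadical hA hX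
    have h2 := hv _ h1
    rw [lie_mulVec, hv X hX, Matrix.mulVec_zero, zero_sub, neg_eq_zero] at h2
    exact h2
  obtain ⟨U, hU, hc⟩ := hTR V₀ hinv
  have hUbot : U = ⊥ := by
    by_contra hne
    obtain ⟨u, huU, hu0, hu⟩ := exists_forall_mulVec_eq_zero hnil hne
      (fun X hX u hu => hU X hX.1 u hu)
    exact hu0 ((Submodule.disjoint_def.1 hc.disjoint) u hu huU)
  have hV : V₀ = ⊤ := by simpa [hUbot] using hc.codisjoint.eq_top
  refine mat_ext fun v => ?_
  have hv : v ∈ V₀ := hV ▸ trivial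
  rw [hv X hX, Matrix.zero_mulVec]

/-- Evaluation of matrices at a vector. -/
def mulVecAt (v : Vec n) : Mat n →ₗ[ℝ] Vec n where
  toFun M := M *ᵥ v
  map_add' M N := Matrix.add_mulVec M N v
  map_smul' c M := Matrix.smul_mulVec c M v

/-- The trace form of a Lie algebra of matrices. -/
noncomputable def traceForm (h : LieSubalgebra ℝ (Mat n)) : LinearMap.BilinForm ℝ h :=
  LinearMap.mk₂ ℝ (fun X Y => -((X : Mat n) * (Y : Mat n)).trace)
    (fun X Y Z => by simp [add_mul]; ring) (fun c X Y => by simp)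
    (fun X Y Z => by simp [mul_add]; ring) (fun c X Y => by simp)

theorem traceForm_apply {h : LieSubalgebra ℝ (Mat n)} (X Y : h) :
    traceForm h X Y = -((X : Mat n) * (Y : Mat n)).trace := rfl

theorem traceForm_isSymm (h : LieSubalgebra ℝ (Mat n)) : (traceForm h).IsSymm :=
  ⟨fun X Y => by simp [traceForm_apply, Matrix.trace_mul_comm (X : Mat n)]⟩

theorem traceForm_lie {h : LieSubalgebra ℝ (Mat n)} (X Y Z : h) :
    traceForm h ⁅X, Y⁆ Z + traceForm h Y ⁅X, Z⁆ = 0 := by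
  rw [traceForm_apply, traceForm_apply, LieSubalgebra.coe_bracket, LieSubalgebra.coe_bracket,
    ← lie_skew, neg_mul, Matrix.trace_neg, trace_lie_mul]
  ring

/-- A Casimir element of a Lie algebra with definite trace form. -/
theorem exists_casimir {h : LieSubalgebra ℝ (Mat n)} (hpos : ∀ X : h, X ≠ 0 → 0 < traceForm h X X) :
    ∃ (m : ℕ) (A : Fin m → Mat n), (∀ i, A i ∈ h) ∧
      h.toSubmodule ≤ Submodule.span ℝ (Set.range A) ∧
      ∀ X ∈ h, X * (∑ i, A i * A i) = (∑ i, A i * A i) * X := by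
  have : Invertible (2 : ℝ) := invertibleOfNonzero two_ne_zero
  obtain ⟨v, hv⟩ := LinearMap.BilinForm.exists_orthogonal_basis
    (LinearMap.BilinForm.isSymm_iff.1 (traceForm_isSymm h))
  set s : Fin (Module.finrank ℝ h) → ℝ := fun i => Real.sqrt (traceForm h (v i) (v i)) with hs
  have hvpos : ∀ i, 0 < traceForm h (v i) (v i) := fun i => hpos _ (v.ne_zero i)
  have hs0 : ∀ i, s i ≠ 0 := fun i => (Real.sqrt_pos.2 (hvpos i)).ne'
  have hs2 : ∀ i, traceForm h (v i) (v i) = s i * s i := fun i =>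
    (Real.mul_self_sqrt (hvpos i).le).symm
  let w : Module.Basis _ ℝ h := v.unitsSMul fun i => (Units.mk0 (s i) (hs0 i))⁻¹
  have hw : ∀ i, w i = (s i)⁻¹ • v i := fun i => by
    simp [w, Module.Basis.unitsSMul_apply, Units.smul_def]
  have hon : ∀ i j, traceForm h (w i) (w j) = if i = j then 1 else 0 := by
    intro i j
    rw [hw, hw]
    simp only [map_smul, LinearMap.smul_apply, smul_eq_mul]
    split_ifs with hij
    · subst hij
      have := hs0 i
      rw [hs2]; field_simp
    · have : traceForm h (v i) (v j) = 0 := hv hij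
      rw [this]; simp
  have hexp : ∀ X : h, X = ∑ j, traceForm h X (w j) • w j := by
    intro X
    conv_lhs => rw [← w.sum_repr X]
    refine Finset.sum_congr rfl fun j _ => congrArg (· • w j) ?_
    conv_rhs => rw [← w.sum_repr X]
    rw [map_sum, LinearMap.sum_apply]
    simp only [map_smul, LinearMap.smul_apply, hon]
    simp
  refine ⟨_, fun i => (w i : Mat n), fun i => (w i).2, ?_, ?_⟩
  · intro X hX
    rw [show X = ((⟨X, hX⟩ : h) : Mat n) from rfl, hexp ⟨X, hX⟩, AddSubmonoidClass.coe_finsetSum]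
    exact Submodule.sum_mem _ fun j _ => Submodule.smul_mem _ _ (Submodule.subset_span ⟨j, rfl⟩)
  · intro X hX
    -- The matrix of ad X in an orthonormal basis. It is skew by invariance of the form, so the
    -- terms of [X, ∑ wᵢ²] cancel in pairs.
    set m : Fin (Module.finrank ℝ h) → Fin (Module.finrank ℝ h) → ℝ :=
      fun i j => traceForm h ⁅(⟨X, hX⟩ : h), w i⁆ (w j) with hm
    have hskew : ∀ i j, m i j = -m j i := by
      intro i j
      have := traceForm_lie (⟨X, hX⟩ : h) (w i) (w j)
      rw [(traceForm_isSymm h).eq (w i)] at this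
      simp only [hm]; linarith
    have hbr : ∀ i, X * (w i : Mat n) - (w i : Mat n) * X = ∑ j, m i j • (w j : Mat n) := by
      intro i
      have := congrArg Subtype.val (hexp ⁅(⟨X, hX⟩ : h), w i⁆)
      rw [AddSubmonoidClass.coe_finsetSum] at this
      exact this
    rw [← sub_eq_zero, Finset.mul_sum, Finset.sum_mul, ← Finset.sum_sub_distrib]
    have h1 : ∀ i, X * ((w i : Mat n) * w i) - (w i : Mat n) * w i * X =
        (∑ j, m i j • ((w j : Mat n) * w i)) + ∑ j, m i j • ((w i : Mat n) * w j) := by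
      intro i
      have e1 : (∑ j, m i j • ((w j : Mat n) * w i)) = (∑ j, m i j • (w j : Mat n)) * w i := by
        rw [Finset.sum_mul]; exact Finset.sum_congr rfl fun j _ => (smul_mul_assoc _ _ _).symm
      have e2 : (∑ j, m i j • ((w i : Mat n) * w j)) =
          (w i : Mat n) * ∑ j, m i j • (w j : Mat n) := by
        rw [Finset.mul_sum]; exact Finset.sum_congr rfl fun j _ => (mul_smul_comm _ _ _).symm
      rw [e1, e2, ← hbr]
      noncomm_ring
    simp only [h1]
    rw [Finset.sum_add_distrib]
    conv_lhs => enter [1]; rw [Finset.sum_comm]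
    rw [← Finset.sum_add_distrib]
    refine Finset.sum_eq_zero fun i _ => ?_
    rw [← Finset.sum_add_distrib]
    refine Finset.sum_eq_zero fun j _ => ?_
    rw [hskew j i, neg_smul, neg_add_cancel]

/-! ### Orthogonal splittings and the existence of a fixed timelike vector -/

theorem isCompl_orth_of_timelike {K : Submodule ℝ (Vec n)} {v : Vec n} (hvK : v ∈ K)
    (hv : g n v v < 0) : IsCompl K (orth K) := by
  refine (LinearMap.BilinForm.isCompl_orthogonal_iff_disjoint (g_isRefl n)).2 ?_
  rw [Submodule.disjoint_def]
  intro x hx hx'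
  by_contra h0
  exact (g_self_pos_of_orth hv (hx' v hvK) h0).ne' (hx' x hx)

theorem orth_invariant {X : Mat n} (hX : X ∈ so n) {K : Submodule ℝ (Vec n)}
    (hK : ∀ u ∈ K, X *ᵥ u ∈ K) {u : Vec n} (hu : u ∈ orth K) : X *ᵥ u ∈ orth K := by
  rw [mem_orth] at hu ⊢
  intro w hw
  have h1 := so_skew hX w u
  rw [hu _ (hK w hw)] at h1
  linarith

/-- The matrix of the projection onto a subspace along a complement. -/
theorem exists_projection {K L : Submodule ℝ (Vec n)} (hKL : IsCompl K L) :
    ∃ P : Mat n, (∀ v ∈ K, P *ᵥ v = v) ∧ (∀ v ∈ L, P *ᵥ v = 0) ∧ (∀ v, P *ᵥ v ∈ K) ∧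
      P.trace = Module.finrank ℝ K := by
  let f : Vec n →ₗ[ℝ] Vec n := K.subtype ∘ₗ Submodule.projectionOnto K L hKL
  have h1 : ∀ v ∈ K, f v = v := fun v hv =>
    congrArg Subtype.val (Submodule.projectionOnto_apply_left hKL ⟨v, hv⟩)
  have h2 : ∀ v ∈ L, f v = 0 := fun v hv =>
    congrArg Subtype.val (Submodule.projectionOnto_apply_right hKL ⟨v, hv⟩)
  have h3 : ∀ v, f v ∈ K := fun v => Subtype.prop _
  refine ⟨LinearMap.toMatrix' f, fun v hv => ?_, fun v hv => ?_, fun v => ?_, ?_⟩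
  · rw [LinearMap.toMatrix'_mulVec, h1 v hv]
  · rw [LinearMap.toMatrix'_mulVec, h2 v hv]
  · rw [LinearMap.toMatrix'_mulVec]; exact h3 v
  · rw [← Matrix.trace_toLin'_eq, Matrix.toLin'_toMatrix']
    exact LinearMap.IsProj.trace ⟨h3, h1⟩

/-- The trace form is definite on `h`, so a Casimir matrix exists and the variational principle
applies to it. A common causal eigenvector is timelike by `hnull`, and skewness forces its
eigenvalues to vanish; a positive Casimir eigenvalue at a timelike vector is excluded by a trace
computation. -/
theorem exists_timelike_of_not_hyperbolic {h : LieSubalgebra ℝ (Mat n)} (hso : h ≤ so n)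
    (hTR : TotallyReducible (h : Set (Mat n))) (hnh : ∀ X ∈ h, ¬Hyperbolic X)
    (hnull : ∀ v : Vec n, v ≠ 0 → g n v v = 0 → ∃ X ∈ h, ∀ c : ℝ, X *ᵥ v ≠ c • v) :
    ∃ v : Vec n, g n v v < 0 ∧ ∀ X ∈ h, X *ᵥ v = 0 := by
  have hpos : ∀ X : h, X ≠ 0 → 0 < traceForm h X X := by
    have hnn : ∀ X : h, 0 ≤ traceForm h X X := fun X => by
      have := (trace_sq_of_not_hyperbolic (hso X.2) (hnh X X.2)).1
      rw [traceForm_apply]; linarith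
    intro X hX
    refine lt_of_le_of_ne (hnn X) fun h0 => hX (Subtype.ext ?_)
    refine traceRadical_eq_zero hso hTR hnh ⟨X.2, fun Y hY => ?_⟩
    -- A null vector of a semidefinite form lies in its radical: expand the form along X + tY and
    -- look at the linear term.
    have hexp : ∀ t : ℝ, 0 ≤ t * (2 * traceForm h X ⟨Y, hY⟩) +
        t ^ 2 * traceForm h ⟨Y, hY⟩ ⟨Y, hY⟩ := by
      intro t
      have := hnn (X + t • ⟨Y, hY⟩)
      simp only [map_add, map_smul, LinearMap.add_apply, LinearMap.smul_apply, smul_eq_mul,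
        ← h0] at this
      rw [(traceForm_isSymm h).eq ⟨Y, hY⟩ X] at this
      linarith
    have hB : traceForm h X ⟨Y, hY⟩ = 0 := by
      have hmin : IsLocalMin (fun t : ℝ => t * (2 * traceForm h X ⟨Y, hY⟩) +
          t ^ 2 * traceForm h ⟨Y, hY⟩ ⟨Y, hY⟩) 0 :=
        Filter.Eventually.of_forall fun t => by simpa using hexp t
      have hder : HasDerivAt (fun t : ℝ => t * (2 * traceForm h X ⟨Y, hY⟩) +
          t ^ 2 * traceForm h ⟨Y, hY⟩ ⟨Y, hY⟩) (2 * traceForm h X ⟨Y, hY⟩) 0 := by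
        convert! ((hasDerivAt_id (0 : ℝ)).mul_const (2 * traceForm h X ⟨Y, hY⟩)).add
          ((hasDerivAt_pow 2 (0 : ℝ)).mul_const (traceForm h ⟨Y, hY⟩ ⟨Y, hY⟩)) using 1
        simp
      have := hmin.hasDerivAt_eq_zero hder
      linarith
    rw [traceForm_apply] at hB
    exact neg_eq_zero.1 hB
  obtain ⟨m, A, hA, hspan, hcas⟩ := exists_casimir hpos
  rcases exists_causal_eigenvector A (fun i => hso (hA i)) with
    ⟨v, hv0, hv, hc⟩ | ⟨v, hv, c, hc, he⟩
  · have hline : ∀ X ∈ h, ∃ c : ℝ, X *ᵥ v = c • v := by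
      intro X hX
      have hle : Submodule.span ℝ (Set.range A) ≤ (Submodule.span ℝ {v}).comap (mulVecAt v) := by
        rw [Submodule.span_le]
        rintro _ ⟨i, rfl⟩
        obtain ⟨c, hc⟩ := hc i
        exact Submodule.mem_span_singleton.2 ⟨c, hc.symm⟩
      obtain ⟨c, hc⟩ := Submodule.mem_span_singleton.1 (hle (hspan hX))
      exact ⟨c, hc.symm⟩
    rcases hv.lt_or_eq with hv | hv
    · refine ⟨v, hv, fun X hX => ?_⟩
      obtain ⟨c, hc⟩ := hline X hX
      have h1 := so_self (hso hX) v
      rw [hc, map_smul, smul_eq_mul, mul_eq_zero] at h1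
      rw [hc, h1.resolve_right hv.ne, zero_smul]
    · obtain ⟨X, hX, hX'⟩ := hnull v hv0 hv
      obtain ⟨c, hc⟩ := hline X hX
      exact absurd hc (hX' c)
  exfalso
  set C := ∑ i, A i * A i with hC
  -- The eigenspace of the Casimir matrix. It is `h`-invariant and contains the timelike `v`, hence
  -- splits off orthogonally; the projection `P` commutes with `h`, and the products `A i * P`
  -- represent the restrictions to `K`.
  let K : Submodule ℝ (Vec n) :=
    { carrier := {u | C *ᵥ u = c • u}
      add_mem' := fun {u v} hu hv => by
        change C *ᵥ (u + v) = c • (u + v)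
        rw [Matrix.mulVec_add, smul_add]; exact congrArg₂ _ hu hv
      zero_mem' := by simp
      smul_mem' := fun a u hu => by
        change C *ᵥ (a • u) = c • (a • u)
        rw [Matrix.mulVec_smul, smul_comm]; exact congrArg _ hu }
  have hvK : v ∈ K := he
  have hKinv : ∀ X ∈ h, ∀ u ∈ K, X *ᵥ u ∈ K := by
    intro X hX u hu
    change C *ᵥ (X *ᵥ u) = c • (X *ᵥ u)
    rw [Matrix.mulVec_mulVec, ← hcas X hX, ← Matrix.mulVec_mulVec, show C *ᵥ u = c • u from hu,
      Matrix.mulVec_smul]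
  have hcompl := isCompl_orth_of_timelike hvK hv
  obtain ⟨P, hP1, hP2, hP3, hPtr⟩ := exists_projection hcompl
  have hPP : ∀ x, P *ᵥ (P *ᵥ x) = P *ᵥ x := fun x => hP1 _ (hP3 x)
  have hdec : ∀ x : Vec n, ∃ y ∈ K, ∃ z ∈ orth K, x = y + z := fun x => by
    obtain ⟨y, hy, z, hz, e⟩ := Submodule.mem_sup.1
      (show x ∈ K ⊔ orth K by rw [hcompl.sup_eq_top]; trivial)
    exact ⟨y, hy, z, hz, e.symm⟩
  have hcomm : ∀ X ∈ h, X * P = P * X := by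
    intro X hX
    refine mat_ext fun x => ?_
    obtain ⟨y, hy, z, hz, rfl⟩ := hdec x
    rw [← Matrix.mulVec_mulVec, ← Matrix.mulVec_mulVec, Matrix.mulVec_add P, Matrix.mulVec_add X,
      Matrix.mulVec_add X, Matrix.mulVec_add P, hP1 y hy, hP2 z hz, hP1 _ (hKinv X hX y hy),
      hP2 _ (orth_invariant (hso hX) (hKinv X hX) hz), Matrix.mulVec_zero]
  have hPsym : ∀ x y, g n (P *ᵥ x) y = g n x (P *ᵥ y) := by
    intro x y
    obtain ⟨x1, hx1, x2, hx2, rfl⟩ := hdec x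
    obtain ⟨y1, hy1, y2, hy2, rfl⟩ := hdec y
    rw [Matrix.mulVec_add, Matrix.mulVec_add, hP1 _ hx1, hP1 _ hy1, hP2 _ hx2, hP2 _ hy2]
    simp only [map_add, LinearMap.add_apply, add_zero, hy2 _ hx1, g_comm x2, hx2 _ hy1]
  have hPso : ∀ i, A i * P ∈ so n := by
    intro i
    rw [mem_so]
    intro x y
    rw [← Matrix.mulVec_mulVec, so_skew (hso (hA i)), hPsym, Matrix.mulVec_mulVec,
      ← hcomm _ (hA i)]
  -- An eigenvector of `A i * P` with nonzero eigenvalue lies in `K`, so it would be one of `A i`,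
  -- which is not hyperbolic.
  have htr : ∀ i, ((A i * P) * (A i * P)).trace ≤ 0 := by
    intro i
    refine (trace_sq_of_not_hyperbolic (hPso i) ?_).1
    rintro ⟨x, hx0, b, hb, hx⟩
    have hxK : x ∈ K := by
      have : x = b⁻¹ • ((A i * P) *ᵥ x) := by rw [hx, smul_smul, inv_mul_cancel₀ hb, one_smul]
      rw [this, hcomm _ (hA i), ← Matrix.mulVec_mulVec]
      exact K.smul_mem _ (hP3 _)
    refine hnh _ (hA i) ⟨x, hx0, b, hb, ?_⟩
    rw [← hx, ← Matrix.mulVec_mulVec, hP1 x hxK]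
  have hsum : ∑ i, (A i * P) * (A i * P) = c • P := by
    have e1 : ∀ i, (A i * P) * (A i * P) = A i * A i * P := by
      intro i
      refine mat_ext fun x => ?_
      rw [mul_assoc (A i) P, ← mul_assoc P, ← hcomm _ (hA i)]
      simp only [← Matrix.mulVec_mulVec, hPP]
    simp only [e1]
    rw [← Finset.sum_mul, ← hC]
    refine mat_ext fun x => ?_
    rw [← Matrix.mulVec_mulVec, Matrix.smul_mulVec]
    exact hP3 x
  have h1 := congrArg Matrix.trace hsum
  rw [Matrix.trace_sum, Matrix.trace_smul, hPtr, smul_eq_mul] at h1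
  have h2 : ∑ i, ((A i * P) * (A i * P)).trace ≤ 0 := Finset.sum_nonpos fun i _ => htr i
  have hv0 : v ≠ 0 := by rintro rfl; simp at hv
  have : Nontrivial K := ⟨⟨v, hvK⟩, 0, fun h0 => hv0 (congrArg Subtype.val h0)⟩
  have h3 : 0 < Module.finrank ℝ K := Module.finrank_pos
  have h4 : 0 < c * (Module.finrank ℝ K : ℝ) := by positivity
  linarith

end Lorentz

/-! ### Invariant subspaces of normal operators -/

open scoped RealInnerProductSpace in
/-- An invariant subspace of a normal operator is invariant under the adjoint. -/
theorem Submodule.adjoint_mem_of_normal {F : Type*} [NormedAddCommGroup F] [InnerProductSpace ℝ F]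
    [FiniteDimensional ℝ F] {T T' : F →ₗ[ℝ] F} (hadj : ∀ x y, ⟪T x, y⟫ = ⟪x, T' y⟫)
    (hnormal : ∀ x, T (T' x) = T' (T x)) {h : Submodule ℝ F} (hT : ∀ x ∈ h, T x ∈ h) :
    ∀ x ∈ h, T' x ∈ h := by
  set b := stdOrthonormalBasis ℝ h with hb
  have hadj' : ∀ x y, ⟪T' x, y⟫ = ⟪x, T y⟫ := fun x y => by
    rw [real_inner_comm, ← hadj, real_inner_comm]
  have hproj : ∀ y : F, ‖h.orthogonalProjectionOnto y‖ ^ 2 = ∑ i, ⟪(b i : F), y⟫ ^ 2 := by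
    intro y
    rw [← b.sum_sq_inner_right]
    refine Finset.sum_congr rfl fun i _ => ?_
    rw [Submodule.inner_orthogonalProjectionOnto_eq_of_mem_left]
  have hTb : ∀ j, ‖T (b j)‖ ^ 2 = ∑ i, ⟪(b i : F), T (b j)⟫ ^ 2 := by
    intro j
    exact (b.sum_sq_inner_right ⟨T (b j), hT _ (b j).2⟩).symm
  have hnorm : ∀ x, ‖T' x‖ ^ 2 = ‖T x‖ ^ 2 := by
    intro x
    rw [← real_inner_self_eq_norm_sq, ← real_inner_self_eq_norm_sq, hadj', hnormal, ← hadj]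
  -- By normality ∑ ‖T'bⱼ‖² = ∑ ‖Tbⱼ‖², and as T preserves `h` this is the sum of all squared
  -- entries ⟪bᵢ, Tbⱼ⟫. The projections of the T'bⱼ to `h` have the transposed entries, so they
  -- already account for the full norm.
  have hsum : ∑ j, (‖T' (b j)‖ ^ 2 - ‖h.orthogonalProjectionOnto (T' (b j))‖ ^ 2) = 0 := by
    rw [Finset.sum_sub_distrib, sub_eq_zero]
    simp only [hproj, hnorm, hTb]
    rw [Finset.sum_comm]
    refine Finset.sum_congr rfl fun i _ => Finset.sum_congr rfl fun j _ => ?_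
    rw [real_inner_comm, hadj]
  have hpyth : ∀ y, ‖y‖ ^ 2 - ‖h.orthogonalProjectionOnto y‖ ^ 2 =
      ‖hᗮ.orthogonalProjectionOnto y‖ ^ 2 := fun y => by
    rw [h.norm_sq_eq_add_norm_sq_projection y]
    ring
  simp only [hpyth] at hsum
  have hz := (Finset.sum_eq_zero_iff_of_nonneg fun i _ => sq_nonneg _).1 hsum
  have hbmem : ∀ j, T' (b j) ∈ h := by
    intro j
    have h0 := pow_eq_zero_iff two_ne_zero |>.1 (hz j (Finset.mem_univ _))
    rw [norm_eq_zero, Submodule.orthogonalProjectionOnto_eq_zero_iff,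
      Submodule.orthogonal_orthogonal] at h0
    exact h0
  intro x hx
  have := congrArg Subtype.val (b.sum_repr ⟨x, hx⟩)
  rw [AddSubmonoidClass.coe_finsetSum] at this
  rw [← show _ = x from this, map_sum]
  refine Submodule.sum_mem _ fun j _ => ?_
  rw [Submodule.coe_smul, map_smul]
  exact h.smul_mem _ (hbmem j)

namespace Lorentz

variable {n : ℕ}

/-- For the inner product tr(XYᵀ) the adjoint of ad A is ad Aᵀ, and ad A is normal when A is. -/
theorem transpose_lie_mem_of_normal {A : Mat n} (hA : A * Aᵀ = Aᵀ * A)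
    {h : Submodule ℝ (Mat n)} (hh : ∀ X ∈ h, ⁅A, X⁆ ∈ h) : ∀ X ∈ h, ⁅Aᵀ, X⁆ ∈ h := by
  let cd : InnerProductSpace.Core ℝ (Mat n) :=
    { inner := fun X Y => (X * Yᵀ).trace
      conj_inner_symm := fun X Y => by
        simp only [conj_trivial]
        rw [← Matrix.trace_transpose, Matrix.transpose_mul, Matrix.transpose_transpose]
      re_inner_nonneg := fun X => show 0 ≤ ∑ i, ∑ j, X i j * X i j from
        Finset.sum_nonneg fun i _ => Finset.sum_nonneg fun j _ => mul_self_nonneg _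
      add_left := fun X Y Z => by simp [add_mul]
      smul_left := fun X Y c => by simp
      definite := fun X hX => by
        change ∑ i, ∑ j, X i j * X i j = 0 at hX
        ext i j
        have h1 := (Finset.sum_eq_zero_iff_of_nonneg fun i _ =>
          Finset.sum_nonneg fun j _ => mul_self_nonneg (X i j)).1 hX i (Finset.mem_univ _)
        have h2 := (Finset.sum_eq_zero_iff_of_nonneg fun j _ => mul_self_nonneg (X i j)).1 h1 j
          (Finset.mem_univ _)
        exact mul_self_eq_zero.1 h2 }
  let _ : NormedAddCommGroup (Mat n) := cd.toNormedAddCommGroup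
  let _ : InnerProductSpace ℝ (Mat n) := InnerProductSpace.ofCore cd.toCore
  let ad : Mat n → (Mat n →ₗ[ℝ] Mat n) := fun A =>
    { toFun := fun X => ⁅A, X⁆
      map_add' := fun X Y => lie_add A X Y
      map_smul' := fun c X => by simp [Ring.lie_def, smul_sub] }
  refine Submodule.adjoint_mem_of_normal (T := ad A) (T' := ad Aᵀ) ?_ ?_ hh
  · intro X Y
    change (⁅A, X⁆ * Yᵀ).trace = (X * ⁅Aᵀ, Y⁆ᵀ).trace
    rw [Ring.lie_def, Ring.lie_def, Matrix.transpose_sub, Matrix.transpose_mul,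
      Matrix.transpose_mul, Matrix.transpose_transpose, sub_mul, mul_sub, Matrix.trace_sub,
      Matrix.trace_sub, mul_assoc A, Matrix.trace_mul_comm A, mul_assoc X, mul_assoc X]
  · intro X
    change ⁅A, ⁅Aᵀ, X⁆⁆ = ⁅Aᵀ, ⁅A, X⁆⁆
    have : ⁅A, Aᵀ⁆ = 0 := by rw [Ring.lie_def, hA, sub_self]
    rw [leibniz_lie, this, zero_lie, zero_add]

/-! ### Bivectors of a Witt pair -/

theorem mem_spaceE {p q v : Vec n} : v ∈ spaceE p q ↔ g n p v = 0 ∧ g n q v = 0 := by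
  rw [spaceE, mem_orth, planeU]
  refine ⟨fun h => ⟨h p (Submodule.subset_span (by simp)), h q (Submodule.subset_span (by simp))⟩,
    fun h w hw => ?_⟩
  obtain ⟨a, b, rfl⟩ := Submodule.mem_span_pair.1 hw
  simp [h.1, h.2]

theorem spaceE_swap (p q : Vec n) : spaceE p q = spaceE q p := by
  ext v
  rw [mem_spaceE, mem_spaceE, and_comm]

theorem orth_spaceE (p q : Vec n) : orth (spaceE p q) = planeU p q := orth_orth _

theorem mem_soSub_spaceE {p q : Vec n} {X : Mat n} (hX : X ∈ so n) (hp : X *ᵥ p = 0)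
    (hq : X *ᵥ q = 0) : X ∈ soSub (spaceE p q) := by
  refine ⟨hX, fun v hv => ?_⟩
  rw [orth_spaceE] at hv
  obtain ⟨a, b, rfl⟩ := Submodule.mem_span_pair.1 hv
  rw [Matrix.mulVec_add, Matrix.mulVec_smul, Matrix.mulVec_smul, hp, hq]
  simp

theorem mulVec_of_mem_soSub_spaceE {p q : Vec n} {X : Mat n} (hX : X ∈ soSub (spaceE p q)) :
    X *ᵥ p = 0 ∧ X *ᵥ q = 0 := by
  have h := hX.2
  rw [orth_spaceE] at h
  exact ⟨h p (Submodule.subset_span (by simp)), h q (Submodule.subset_span (by simp))⟩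

section WittPair

variable {p q : Vec n} (hpq : IsWittPair p q)
include hpq

theorem IsWittPair.wedge_left : wedge p q *ᵥ p = p := by
  rw [wedge_mulVec, hpq.pair', hpq.left]; simp

theorem IsWittPair.wedge_right : wedge p q *ᵥ q = -q := by
  rw [wedge_mulVec, hpq.right, hpq.pair]; simp

omit hpq in
theorem wedge_mulVec_spaceE {x : Vec n} (hx : x ∈ spaceE p q) : wedge p q *ᵥ x = 0 := by
  rw [wedge_mulVec, (mem_spaceE.1 hx).1, (mem_spaceE.1 hx).2]; simp

/-- Bracketing with `p ∧ q` isolates the components of `X` in `p ∧ E` and `q ∧ E`. -/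
theorem IsWittPair.lie_wedge_eq {X : Mat n} (hX : X ∈ so n) :
    g n (X *ᵥ p) q • p - X *ᵥ p ∈ spaceE p q ∧ -g n (X *ᵥ p) q • q - X *ᵥ q ∈ spaceE p q ∧
      ⁅wedge p q, X⁆ = wedge p (-g n (X *ᵥ p) q • q - X *ᵥ q) -
        wedge q (g n (X *ᵥ p) q • p - X *ᵥ p) := by
  have h1 : g n p (X *ᵥ p) = 0 := so_self hX p
  have h2 : g n q (X *ᵥ q) = 0 := so_self hX q
  have h3 : g n q (X *ᵥ p) = g n (X *ᵥ p) q := g_comm _ _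
  have h4 : g n p (X *ᵥ q) = -g n (X *ᵥ p) q := by rw [so_skew hX, neg_neg]
  refine ⟨mem_spaceE.2 ⟨?_, ?_⟩, mem_spaceE.2 ⟨?_, ?_⟩, ?_⟩
  · simp [h1, hpq.left]
  · simp [h3, hpq.pair']
  · simp [h4, hpq.pair]
  · simp [h2, hpq.right]
  · rw [← lie_skew, lie_wedge hX, wedge_sub_right, wedge_sub_right, wedge_smul_right,
      wedge_smul_right, wedge_swap q p, wedge_swap q (X *ᵥ p)]
    module

/-- If p - q lies on the time axis, `q` is the time reflection of `p`, and p∧q is the symmetric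
matrix ppᵀ - qqᵀ. -/
theorem IsWittPair.wedge_transpose {c : ℝ} (hc : c ≠ 0) (h : p - q = c • Pi.single 0 1) :
    (wedge p q)ᵀ = wedge p q := by
  have hsucc : ∀ i : Fin (n + 1), p i.succ = q i.succ := fun i => by
    have := congrFun h i.succ
    simpa [sub_eq_zero] using this
  have h0 : p 0 - q 0 = c := by simpa using congrFun h 0
  have h1 : p 0 = -q 0 := by
    have hp := hpq.left
    have hq := hpq.right
    rw [g_apply] at hp hq
    simp only [hsucc] at hp
    have : (p 0 - q 0) * (p 0 + q 0) = 0 := by linarith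
    rw [h0] at this
    linarith [(mul_eq_zero.1 this).resolve_left hc]
  have hp : gram n *ᵥ p = q := by
    ext i
    rw [gram, Matrix.mulVec_diagonal]
    refine Fin.cases ?_ (fun j => ?_) i
    · simp [h1]
    · simp [hsucc]
  have hq : gram n *ᵥ q = p := by rw [← hp, gram_mulVec_gram_mulVec]
  rw [wedge, hp, hq, Matrix.transpose_sub, Matrix.transpose_vecMulVec, Matrix.transpose_vecMulVec]

/-- Move p - q to the time axis. Then A = p∧q + C is the sum of a symmetric and a skew matrix that
commute, hence normal. The conjugate of `h` is stable under ad A and so under ad Aᵀ; half their sum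
is ad(p∧q). -/
theorem IsWittPair.lie_wedge_mem {h : LieSubalgebra ℝ (Mat n)} (hso : h ≤ so n) {A : Mat n}
    (hA : A ∈ h) (hAp : A *ᵥ p = p) (hAq : A *ᵥ q = -q) {X : Mat n} (hX : X ∈ h) :
    ⁅wedge p q, X⁆ ∈ h := by
  obtain ⟨a, ha, c, hc, hac⟩ := exists_SO0_mulVec_time (v := p - q) (by rw [hpq.g_sub]; norm_num)
  set C := A - wedge p q with hC
  have hCs : C ∈ so n := sub_mem (hso hA) (wedge_mem_so p q)
  have hCp : C *ᵥ p = 0 := by rw [hC, Matrix.sub_mulVec, hAp, hpq.wedge_left, sub_self]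
  have hCq : C *ᵥ q = 0 := by rw [hC, Matrix.sub_mulVec, hAq, hpq.wedge_right, sub_self]
  have hcomm : ⁅C, wedge p q⁆ = 0 := by
    rw [lie_wedge hCs, hCp, hCq, wedge_zero_left, wedge_zero_right, add_zero]
  have e : (a⁻¹).1 * a.1 = 1 := by rw [← Units.val_mul, inv_mul_cancel, Units.val_one]
  have hlie := conj_lie a
  set W' := a.1 * wedge p q * (a⁻¹).1 with hW'
  set C' := a.1 * C * (a⁻¹).1 with hC'
  have hWw : W' = wedge ((a : Mat n) *ᵥ p) ((a : Mat n) *ᵥ q) := by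
    refine mat_ext fun x => ?_
    rw [← coe_mulVec_inv a x, hW', conj_mulVec, wedge_mulVec, wedge_mulVec,
      g_mulVec_of_mem_SO0 ha, g_mulVec_of_mem_SO0 ha, Matrix.mulVec_sub, Matrix.mulVec_smul,
      Matrix.mulVec_smul]
  have hw' : IsWittPair ((a : Mat n) *ᵥ p) ((a : Mat n) *ᵥ q) :=
    ⟨by rw [g_mulVec_of_mem_SO0 ha, hpq.left], by rw [g_mulVec_of_mem_SO0 ha, hpq.right],
      by rw [g_mulVec_of_mem_SO0 ha, hpq.pair]⟩
  have hWt : W'ᵀ = W' := by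
    rw [hWw]
    exact hw'.wedge_transpose hc (by rw [← Matrix.mulVec_sub, hac])
  have hCt : C'ᵀ = -C' := by
    apply transpose_eq_neg_of_mulVec_time (conj_mem_so ha hCs) hc
    rw [← hac, conj_mulVec, Matrix.mulVec_sub, hCp, hCq, sub_zero, Matrix.mulVec_zero]
  have hcomm' : C' * W' = W' * C' := by
    have := hlie C (wedge p q)
    rw [hcomm, mul_zero, zero_mul, Ring.lie_def] at this
    exact sub_eq_zero.1 this
  have hA' : a.1 * A * (a⁻¹).1 = W' + C' := by
    rw [hW', hC', hC]; noncomm_ring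
  have hAmem : W' + C' ∈ conj a h := ⟨A, hA, hA'.symm⟩
  have hnorm : (W' + C') * (W' + C')ᵀ = (W' + C')ᵀ * (W' + C') := by
    rw [Matrix.transpose_add, hWt, hCt]
    linear_combination (norm := noncomm_ring) 2 • hcomm'
  have hY : a.1 * X * (a⁻¹).1 ∈ conj a h := ⟨X, hX, rfl⟩
  have h1 := (conj a h).lie_mem hAmem hY
  have h2 := transpose_lie_mem_of_normal hnorm (h := (conj a h).toSubmodule)
    (fun Y hY => (conj a h).lie_mem hAmem hY) _ hY
  have h3 : ⁅W', a.1 * X * (a⁻¹).1⁆ ∈ conj a h := by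
    have h4 : ⁅W', a.1 * X * (a⁻¹).1⁆ = (1 / 2 : ℝ) • (⁅W' + C', a.1 * X * (a⁻¹).1⁆ +
        ⁅(W' + C')ᵀ, a.1 * X * (a⁻¹).1⁆) := by
      rw [← add_lie, Matrix.transpose_add, hWt, hCt,
        show W' + C' + (W' + -C') = W' + W' by abel, add_lie]
      module
    rw [h4]
    exact (conj a h).smul_mem _ (add_mem h1 h2)
  rw [hW', hlie] at h3
  obtain ⟨Z, hZ, hZe⟩ := h3
  have : ⁅wedge p q, X⁆ = Z := by
    have h5 := congrArg (fun M => (a⁻¹).1 * M * a.1) hZe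
    rw [show ∀ M : Mat n, (a⁻¹).1 * (a.1 * M * (a⁻¹).1) * a.1 =
      ((a⁻¹).1 * a.1) * M * ((a⁻¹).1 * a.1) from fun M => by noncomm_ring,
      show ∀ M : Mat n, (a⁻¹).1 * (a.1 * M * (a⁻¹).1) * a.1 =
      ((a⁻¹).1 * a.1) * M * ((a⁻¹).1 * a.1) from fun M => by noncomm_ring, e] at h5
    simpa using h5
  rw [this]; exact hZ

/-- ad(p∧q) acts as 1 on p∧E and as -1 on q∧E and kills the rest of so(V), so applying it once and
twice separates the two components. -/
theorem IsWittPair.wedge_components_mem {h : LieSubalgebra ℝ (Mat n)} (hso : h ≤ so n)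
    (hd : ∀ X ∈ h, ⁅wedge p q, X⁆ ∈ h) {X : Mat n} (hX : X ∈ h) :
    wedge p (-g n (X *ᵥ p) q • q - X *ᵥ q) ∈ h ∧ wedge q (g n (X *ᵥ p) q • p - X *ᵥ p) ∈ h := by
  obtain ⟨hy, hx, he⟩ := hpq.lie_wedge_eq (hso hX)
  set x := -g n (X *ᵥ p) q • q - X *ᵥ q
  set y := g n (X *ᵥ p) q • p - X *ᵥ p
  have h1 := hd X hX
  rw [he] at h1
  have h2 := hd _ h1
  have h3 : ⁅wedge p q, wedge p x - wedge q y⁆ = wedge p x + wedge q y := by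
    rw [lie_sub, lie_wedge (wedge_mem_so p q), lie_wedge (wedge_mem_so p q), hpq.wedge_left,
      hpq.wedge_right, wedge_mulVec_spaceE hx, wedge_mulVec_spaceE hy, wedge_zero_right,
      wedge_zero_right, wedge_neg_left]
    abel
  rw [h3] at h2
  constructor
  · have : wedge p x = (1 / 2 : ℝ) • ((wedge p x + wedge q y) + (wedge p x - wedge q y)) := by
      module
    rw [this]; exact h.smul_mem _ (add_mem h2 h1)
  · have : wedge q y = (1 / 2 : ℝ) • ((wedge p x + wedge q y) - (wedge p x - wedge q y)) := by
      module
    rw [this]; exact h.smul_mem _ (sub_mem h2 h1)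

theorem IsWittPair.lie_wedge_wedge {x y : Vec n} (hx : x ∈ spaceE p q) (hy : y ∈ spaceE p q) :
    ⁅wedge p x, wedge q y⁆ = -wedge x y - g n x y • wedge p q := by
  rw [lie_wedge (wedge_mem_so p x), wedge_mulVec, wedge_mulVec, hpq.pair, g_comm x q,
    (mem_spaceE.1 hx).2, (mem_spaceE.1 hy).1, zero_smul, zero_smul, sub_zero, one_smul,
    zero_sub, wedge_neg_left, wedge_smul_right, wedge_swap q p, smul_neg, ← sub_eq_add_neg]

theorem IsWittPair.g_pos_of_mem_spaceE {x : Vec n} (hx : x ∈ spaceE p q) (hx0 : x ≠ 0) :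
    0 < g n x x := by
  refine g_self_pos_of_orth (v := p - q) (by rw [hpq.g_sub]; norm_num) ?_ hx0
  rw [map_sub, LinearMap.sub_apply, (mem_spaceE.1 hx).1, (mem_spaceE.1 hx).2, sub_zero]

/-- The bracket [[p∧x, q∧y], p∧x] equals g(x,x) p∧y - 2 g(x,y) p∧x, and g(x,x) > 0. One nonzero p∧x
in `h` thus turns every q∧y in `h` into p∧y. -/
theorem IsWittPair.wedge_left_mem_of_right {h : LieSubalgebra ℝ (Mat n)} {x y : Vec n}
    (hx : x ∈ spaceE p q) (hx0 : x ≠ 0) (hpx : wedge p x ∈ h) (hy : y ∈ spaceE p q)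
    (hqy : wedge q y ∈ h) : wedge p y ∈ h := by
  have h1 := h.lie_mem (h.lie_mem hpx hqy) hpx
  rw [hpq.lie_wedge_wedge hx hy, lie_wedge (sub_mem (neg_mem (wedge_mem_so x y))
    ((so n).smul_mem _ (wedge_mem_so p q)))] at h1
  simp only [Matrix.sub_mulVec, Matrix.neg_mulVec, Matrix.smul_mulVec, hpq.wedge_left,
    wedge_mulVec_spaceE hx, wedge_mulVec, g_comm y p, g_comm x p, (mem_spaceE.1 hx).1,
    (mem_spaceE.1 hy).1, zero_smul, sub_zero, neg_zero, zero_sub, smul_zero,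
    wedge_neg_left, wedge_smul_left, wedge_neg_right, wedge_sub_right, wedge_smul_right] at h1
  have hxx := hpq.g_pos_of_mem_spaceE hx hx0
  have h2 : wedge p y = (g n x x)⁻¹ • ((-(g n x y • wedge p x) +
      -(g n y x • wedge p x - g n x x • wedge p y)) + (2 * g n x y) • wedge p x) := by
    rw [g_comm y x]
    have : (-(g n x y • wedge p x) + -(g n x y • wedge p x - g n x x • wedge p y)) +
        (2 * g n x y) • wedge p x = g n x x • wedge p y := by module
    rw [this, smul_smul, inv_mul_cancel₀ hxx.ne', one_smul]
  rw [h2]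
  exact h.smul_mem _ (add_mem h1 (h.smul_mem _ hpx))

end WittPair

/-! ### The algebra of a non-degenerate subspace -/

/-- The restriction of a skew-symmetric endomorphism to a non-degenerate invariant subspace,
extended by zero, is a combination of bivectors. -/
theorem exists_restriction {W : Submodule ℝ (Vec n)} (hW : IsCompl W (orth W)) {X : Mat n}
    (hX : X ∈ so n) (hXW : ∀ w ∈ W, X *ᵥ w ∈ W) :
    ∃ Y ∈ Submodule.span ℝ {Z : Mat n | ∃ u ∈ W, ∃ v ∈ W, Z = wedge u v},
      Y ∈ soSub W ∧ ∀ z ∈ W, Y *ᵥ z = X *ᵥ z := by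
  have : Invertible (2 : ℝ) := invertibleOfNonzero two_ne_zero
  obtain ⟨v, hv⟩ := LinearMap.BilinForm.exists_orthogonal_basis (B := (g n).restrict W)
    (LinearMap.BilinForm.isSymm_iff.1 ((g_isSymm n).restrict W))
  have hort : ∀ i j, i ≠ j → g n (v i : Vec n) (v j) = 0 := fun i j hij => hv hij
  have hsum : ∀ z : W, (z : Vec n) = ∑ i, v.repr z i • (v i : Vec n) := fun z => by
    conv_lhs => rw [← v.sum_repr z]
    rw [AddSubmonoidClass.coe_finsetSum]
    rfl
  have hcoef : ∀ (z : W) j, g n (v j : Vec n) z = v.repr z j * g n (v j : Vec n) (v j) := by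
    intro z j
    rw [hsum z, map_sum, Finset.sum_eq_single j]
    · rw [map_smul, smul_eq_mul]
    · intro i _ hij
      rw [map_smul, hort j i hij.symm, smul_zero]
    · simp
  have hne : ∀ i, g n (v i : Vec n) (v i) ≠ 0 := by
    intro i h0
    apply v.ne_zero i
    apply Subtype.ext
    refine Submodule.disjoint_def.1 hW.disjoint _ (v i).2 fun w hw => ?_
    rw [g_comm, hcoef ⟨w, hw⟩ i, h0, mul_zero]
  have hexp : ∀ z ∈ W, ∑ i, (g n (v i : Vec n) (v i))⁻¹ • g n (v i : Vec n) z • (v i : Vec n)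
      = z := by
    intro z hz
    refine Eq.trans ?_ (hsum ⟨z, hz⟩).symm
    refine Finset.sum_congr rfl fun i _ => ?_
    rw [hcoef ⟨z, hz⟩ i, smul_smul, mul_comm (v.repr _ i), inv_mul_cancel_left₀ (hne i)]
  -- On `W` the two halves of each bivector sum separately to X, by skewness of X; this is the
  -- reason for the factor 1/2.
  set Y : Mat n := (1 / 2 : ℝ) • ∑ i, (g n (v i : Vec n) (v i))⁻¹ •
    wedge (X *ᵥ (v i : Vec n)) (v i) with hY
  have hYz : ∀ z, Y *ᵥ z = (1 / 2 : ℝ) • ∑ i, (g n (v i : Vec n) (v i))⁻¹ •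
      (g n (v i : Vec n) z • X *ᵥ (v i : Vec n) + g n (v i : Vec n) (X *ᵥ z) • (v i : Vec n)) := by
    intro z
    rw [hY, Matrix.smul_mulVec, Matrix.sum_mulVec]
    simp only [Matrix.smul_mulVec, wedge_mulVec, so_skew hX, neg_smul, sub_neg_eq_add]
  refine ⟨Y, ?_, ⟨?_, fun z hz => ?_⟩, fun z hz => ?_⟩
  · refine Submodule.smul_mem _ _ (Submodule.sum_mem _ fun i _ => Submodule.smul_mem _ _ ?_)
    exact Submodule.subset_span ⟨_, hXW _ (v i).2, _, (v i).2, rfl⟩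
  · exact (so n).smul_mem _ (sum_mem fun i _ => (so n).smul_mem _ (wedge_mem_so _ _))
  · rw [hYz]
    simp [hz _ (v _).2, orth_invariant hX hXW hz _ (v _).2]
  · rw [hYz]
    have h1 : ∑ i, (g n (v i : Vec n) (v i))⁻¹ • g n (v i : Vec n) z • X *ᵥ (v i : Vec n) =
        X *ᵥ z := by
      conv_rhs => rw [← hexp z hz, Matrix.mulVec_sum]
      simp only [Matrix.mulVec_smul]
    simp only [smul_add, Finset.sum_add_distrib]
    rw [h1, hexp _ (hXW z hz)]
    module

theorem mulVec_mem_of_mem_soSub {W : Submodule ℝ (Vec n)} {X : Mat n} (hX : X ∈ soSub W)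
    (v : Vec n) : X *ᵥ v ∈ W := by
  rw [← orth_orth W, mem_orth]
  intro w hw
  have h1 := so_skew hX.1 w v
  rw [hX.2 w hw] at h1
  simpa using h1.symm

theorem soSub_le_span_wedge {W : Submodule ℝ (Vec n)} (hW : IsCompl W (orth W)) :
    (soSub W).toSubmodule ≤
      Submodule.span ℝ {Z : Mat n | ∃ u ∈ W, ∃ v ∈ W, Z = wedge u v} := by
  intro X hX
  obtain ⟨Y, hY, hYW, he⟩ := exists_restriction hW hX.1 fun w _ => mulVec_mem_of_mem_soSub hX w
  have : X = Y := by
    refine mat_ext fun x => ?_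
    obtain ⟨y, hy, z, hz, rfl⟩ := Submodule.mem_sup.1
      (show x ∈ W ⊔ orth W by rw [hW.sup_eq_top]; trivial)
    rw [Matrix.mulVec_add, Matrix.mulVec_add, he y hy, hX.2 z hz, hYW.2 z hz]
  rw [this]; exact hY

theorem traceForm_pos_of_timelike {k : LieSubalgebra ℝ (Mat n)} {v : Vec n} (hv : g n v v < 0)
    (hk : k ≤ so n) (hkv : ∀ X ∈ k, X *ᵥ v = 0) (X : k) (hX : X ≠ 0) : 0 < traceForm k X X := by
  obtain ⟨h1, h2⟩ := trace_sq_of_mulVec_timelike (hk X.2) hv (hkv X X.2)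
  rw [traceForm_apply]
  refine lt_of_le_of_ne (by linarith) fun h0 => hX (Subtype.ext (h2 (by linarith)))

theorem isCompactLieAlgebra_of_timelike {k : LieSubalgebra ℝ (Mat n)} {v : Vec n}
    (hv : g n v v < 0) (hk : k ≤ so n) (hkv : ∀ X ∈ k, X *ᵥ v = 0) : IsCompactLieAlgebra k :=
  ⟨traceForm k, traceForm_isSymm k, traceForm_pos_of_timelike hv hk hkv, traceForm_lie⟩

/-! ### Type II -/

theorem mem_spaceV {p q : Vec n} {H : Submodule ℝ (Vec n)} {v : Vec n} :
    v ∈ spaceV p q H ↔ ∃ a b : ℝ, ∃ x ∈ H, v = a • p + x + b • q := by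
  rw [spaceV, Submodule.mem_sup]
  constructor
  · rintro ⟨y, hy, z, hz, rfl⟩
    obtain ⟨w, hw, x, hx, rfl⟩ := Submodule.mem_sup.1 hy
    obtain ⟨a, rfl⟩ := Submodule.mem_span_singleton.1 hw
    obtain ⟨b, rfl⟩ := Submodule.mem_span_singleton.1 hz
    exact ⟨a, b, x, hx, rfl⟩
  · rintro ⟨a, b, x, hx, rfl⟩
    exact ⟨_, Submodule.add_mem_sup (Submodule.mem_span_singleton.2 ⟨a, rfl⟩) hx, _,
      Submodule.mem_span_singleton.2 ⟨b, rfl⟩, rfl⟩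

theorem left_mem_spaceV (p q : Vec n) (H : Submodule ℝ (Vec n)) : p ∈ spaceV p q H :=
  mem_spaceV.2 ⟨1, 0, 0, zero_mem _, by simp⟩

theorem right_mem_spaceV (p q : Vec n) (H : Submodule ℝ (Vec n)) : q ∈ spaceV p q H :=
  mem_spaceV.2 ⟨0, 1, 0, zero_mem _, by simp⟩

theorem mem_spaceV_of_mem {p q : Vec n} {H : Submodule ℝ (Vec n)} {x : Vec n} (hx : x ∈ H) :
    x ∈ spaceV p q H :=
  mem_spaceV.2 ⟨0, 0, x, hx, by simp⟩

theorem IsWittPair.isCompl_spaceV {p q : Vec n} (hpq : IsWittPair p q)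
    (H : Submodule ℝ (Vec n)) : IsCompl (spaceV p q H) (orth (spaceV p q H)) :=
  isCompl_orth_of_timelike (sub_mem (left_mem_spaceV p q H) (right_mem_spaceV p q H))
    (by rw [hpq.g_sub]; norm_num)

theorem IsWittPair.three_le_finrank_spaceV {p q x : Vec n} (hpq : IsWittPair p q)
    {H : Submodule ℝ (Vec n)} (hxE : x ∈ spaceE p q) (hx : x ∈ H) (hx0 : x ≠ 0) :
    3 ≤ Module.finrank ℝ (spaceV p q H) := by
  have hli : LinearIndependent ℝ ![p, q, x] := by
    rw [Fintype.linearIndependent_iff]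
    intro a ha
    rw [Fin.sum_univ_three] at ha
    change a 0 • p + a 1 • q + a 2 • x = 0 at ha
    have h1 := congrArg (g n q) ha
    have h2 := congrArg (g n p) ha
    have h3 := congrArg (g n x) ha
    simp only [map_add, map_smul, smul_eq_mul, map_zero, hpq.left, hpq.right, hpq.pair, hpq.pair',
      (mem_spaceE.1 hxE).1, (mem_spaceE.1 hxE).2, g_comm x p, g_comm x q, mul_zero, mul_one,
      add_zero, zero_add] at h1 h2 h3
    have h4 := (mul_eq_zero.1 h3).resolve_right (hpq.g_pos_of_mem_spaceE hxE hx0).ne'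
    intro i
    fin_cases i <;> assumption
  have h1 := finrank_span_eq_card hli
  refine le_trans (le_of_eq ((Fintype.card_fin 3).symm.trans h1.symm)) (Submodule.finrank_mono ?_)
  rw [Submodule.span_le]
  rintro _ ⟨i, rfl⟩
  fin_cases i
  · exact left_mem_spaceV p q H
  · exact right_mem_spaceV p q H
  · exact mem_spaceV_of_mem hx

/-- Since neither null line is preserved, `h` contains nonzero bivectors p∧x and q∧y, and by the
double bracket the same vectors of E occur on both sides. They form H; their brackets give all
bivectors of V(H), and V(H) turns out to be invariant, so subtracting the restriction to V(H) leaves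
elements supported on its complement. -/
theorem IsWittPair.isTypeII {p q : Vec n} (hpq : IsWittPair p q) {h : LieSubalgebra ℝ (Mat n)}
    (hso : h ≤ so n) {A : Mat n} (hA : A ∈ h) (hAp : A *ᵥ p = p) (hAq : A *ᵥ q = -q)
    (hp : ∃ X ∈ h, ∀ c : ℝ, X *ᵥ p ≠ c • p) (hq : ∃ X ∈ h, ∀ c : ℝ, X *ᵥ q ≠ c • q) :
    IsTypeII p q h := by
  have hd : ∀ X ∈ h, ⁅wedge p q, X⁆ ∈ h := fun X hX => hpq.lie_wedge_mem hso hA hAp hAq hX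
  have hcomp := fun X (hX : X ∈ h) => hpq.wedge_components_mem hso hd hX
  have hmemE := fun X (hX : X ∈ h) => hpq.lie_wedge_eq (hso hX)
  obtain ⟨x₀, hx₀E, hx₀, hpx₀⟩ : ∃ x ∈ spaceE p q, x ≠ 0 ∧ wedge p x ∈ h := by
    obtain ⟨X, hX, hXc⟩ := hq
    exact ⟨_, (hmemE X hX).2.1, fun h0 => hXc _ (sub_eq_zero.1 h0).symm, (hcomp X hX).1⟩
  obtain ⟨y₀, hy₀E, hy₀, hqy₀⟩ : ∃ y ∈ spaceE p q, y ≠ 0 ∧ wedge q y ∈ h := by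
    obtain ⟨X, hX, hXc⟩ := hp
    exact ⟨_, (hmemE X hX).1, fun h0 => hXc _ (sub_eq_zero.1 h0).symm, (hcomp X hX).2⟩
  have hqp : ∀ y ∈ spaceE p q, wedge q y ∈ h → wedge p y ∈ h := fun y hy hqy =>
    hpq.wedge_left_mem_of_right hx₀E hx₀ hpx₀ hy hqy
  have hpqmem : ∀ x ∈ spaceE p q, wedge p x ∈ h → wedge q x ∈ h := fun x hx hpx =>
    hpq.symm.wedge_left_mem_of_right (spaceE_swap p q ▸ hy₀E) hy₀ hqy₀ (spaceE_swap p q ▸ hx) hpx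
  let H : Submodule ℝ (Vec n) :=
    { carrier := {x | x ∈ spaceE p q ∧ wedge p x ∈ h}
      add_mem' := fun {x y} hx hy => ⟨add_mem hx.1 hy.1, by
        rw [wedge_add_right]; exact add_mem hx.2 hy.2⟩
      zero_mem' := ⟨zero_mem _, by rw [wedge_zero_right]; exact zero_mem _⟩
      smul_mem' := fun c x hx => ⟨Submodule.smul_mem _ c hx.1, by
        rw [wedge_smul_right]; exact h.smul_mem c hx.2⟩ }
  set W := spaceV p q H with hW
  have hpW : p ∈ W := left_mem_spaceV p q H
  have hqW : q ∈ W := right_mem_spaceV p q H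
  have hcompl : IsCompl W (orth W) := hpq.isCompl_spaceV H
  -- bivectors of `W` lie in `h`
  have hpair : ∀ x ∈ H, ∀ y ∈ H, -wedge x y - g n x y • wedge p q ∈ h := fun x hx y hy => by
    rw [← hpq.lie_wedge_wedge hx.1 hy.1]
    exact h.lie_mem hx.2 (hpqmem y hy.1 hy.2)
  have hwpq : wedge p q ∈ h := by
    have h1 := hpair x₀ ⟨hx₀E, hpx₀⟩ x₀ ⟨hx₀E, hpx₀⟩
    rw [wedge_self, neg_zero, zero_sub, ← neg_smul] at h1
    have h2 := h.smul_mem (-g n x₀ x₀)⁻¹ h1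
    rwa [smul_smul, inv_mul_cancel₀ (neg_ne_zero.2 (hpq.g_pos_of_mem_spaceE hx₀E hx₀).ne'),
      one_smul] at h2
  have hxy : ∀ x ∈ H, ∀ y ∈ H, wedge x y ∈ h := fun x hx y hy => by
    have h1 := add_mem (hpair x hx y hy) (h.smul_mem (g n x y) hwpq)
    rw [sub_add_cancel] at h1
    simpa using neg_mem h1
  have hwW : ∀ u ∈ W, ∀ v ∈ W, wedge u v ∈ h := by
    have hpv : ∀ v ∈ W, wedge p v ∈ h := by
      intro v hv
      obtain ⟨a, b, x, hx, rfl⟩ := mem_spaceV.1 hv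
      rw [wedge_add_right, wedge_add_right, wedge_smul_right, wedge_smul_right, wedge_self,
        smul_zero, zero_add]
      exact add_mem hx.2 (h.smul_mem _ hwpq)
    have hqv : ∀ v ∈ W, wedge q v ∈ h := by
      intro v hv
      obtain ⟨a, b, x, hx, rfl⟩ := mem_spaceV.1 hv
      rw [wedge_add_right, wedge_add_right, wedge_smul_right, wedge_smul_right, wedge_self,
        smul_zero, add_zero, wedge_swap q p]
      exact add_mem (h.smul_mem _ (neg_mem hwpq)) (hpqmem x hx.1 hx.2)
    have hxv : ∀ x ∈ H, ∀ v ∈ W, wedge x v ∈ h := by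
      intro x hx v hv
      obtain ⟨a, b, y, hy, rfl⟩ := mem_spaceV.1 hv
      rw [wedge_add_right, wedge_add_right, wedge_smul_right, wedge_smul_right, wedge_swap x p,
        wedge_swap x q]
      exact add_mem (add_mem (h.smul_mem _ (neg_mem hx.2)) (hxy x hx y hy))
        (h.smul_mem _ (neg_mem (hpqmem x hx.1 hx.2)))
    intro u hu v hv
    obtain ⟨a, b, x, hx, rfl⟩ := mem_spaceV.1 hu
    rw [wedge_add_left, wedge_add_left, wedge_smul_left, wedge_smul_left]
    exact add_mem (add_mem (h.smul_mem _ (hpv v hv)) (hxv x hx v hv)) (h.smul_mem _ (hqv v hv))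
  have hspan : Submodule.span ℝ {Z : Mat n | ∃ u ∈ W, ∃ v ∈ W, Z = wedge u v} ≤
      h.toSubmodule := by
    rw [Submodule.span_le]
    rintro _ ⟨u, hu, v, hv, rfl⟩
    exact hwW u hu v hv
  -- `W` is invariant
  have hXq : ∀ X ∈ h, X *ᵥ q ∈ W := by
    intro X hX
    have h1 : X *ᵥ q = -g n (X *ᵥ p) q • q - (-g n (X *ᵥ p) q • q - X *ᵥ q) := by abel
    rw [h1]
    exact sub_mem (W.smul_mem _ hqW)
      (mem_spaceV_of_mem ⟨(hmemE X hX).2.1, (hcomp X hX).1⟩)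
  have hXp : ∀ X ∈ h, X *ᵥ p ∈ W := by
    intro X hX
    have h1 : X *ᵥ p = g n (X *ᵥ p) q • p - (g n (X *ᵥ p) q • p - X *ᵥ p) := by abel
    rw [h1]
    exact sub_mem (W.smul_mem _ hpW) (mem_spaceV_of_mem
      ⟨(hmemE X hX).1, hqp _ (hmemE X hX).1 (hcomp X hX).2⟩)
  have hXx : ∀ X ∈ h, ∀ x ∈ H, X *ᵥ x ∈ W := by
    intro X hX x hx
    have hxW : x ∈ W := mem_spaceV_of_mem hx
    -- Applied to `q`, the bracket of `X` with p∧x yields -Xx modulo multiples of `p` and `x`, which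
    -- reduces this case to `hXq`.
    have h1 := hXq _ (h.lie_mem hX hx.2)
    rw [lie_mulVec, wedge_mulVec, wedge_mulVec, hpq.pair, g_comm x q, (mem_spaceE.1 hx.1).2,
      zero_smul, zero_sub, one_smul, Matrix.mulVec_neg] at h1
    have h2 := add_mem h1 (sub_mem (W.smul_mem (g n x (X *ᵥ q)) hpW)
      (W.smul_mem (g n p (X *ᵥ q)) hxW))
    rw [sub_add_cancel] at h2
    simpa using neg_mem h2
  have hXW : ∀ X ∈ h, ∀ w ∈ W, X *ᵥ w ∈ W := by
    intro X hX w hw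
    obtain ⟨a, b, x, hx, rfl⟩ := mem_spaceV.1 hw
    rw [Matrix.mulVec_add, Matrix.mulVec_add, Matrix.mulVec_smul, Matrix.mulVec_smul]
    exact add_mem (add_mem (W.smul_mem _ (hXp X hX)) (hXx X hX x hx)) (W.smul_mem _ (hXq X hX))
  have hkill : ∀ X ∈ h ⊓ soSub (orth W), ∀ w ∈ W, X *ᵥ w = 0 := fun X hX w hw =>
    hX.2.2 w (by rw [orth_orth]; exact hw)
  refine ⟨H, fun x hx => hx.1, hpq.three_le_finrank_spaceV hx₀E ⟨hx₀E, hpx₀⟩ hx₀,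
    h ⊓ soSub (orth W), inf_le_right, ?_, ?_⟩
  · exact isCompactLieAlgebra_of_timelike (v := p - q) (by rw [hpq.g_sub]; norm_num)
      (fun X hX => hso hX.1) fun X hX => hkill X hX _ (sub_mem hpW hqW)
  · apply le_antisymm
    · intro X hX
      obtain ⟨Y, hY, hYW, he⟩ := exists_restriction hcompl (hso hX) (hXW X hX)
      rw [show X = Y + (X - Y) by abel]
      refine Submodule.add_mem_sup hYW ⟨sub_mem hX (hspan hY), sub_mem (hso hX) hYW.1, ?_⟩
      intro w hw
      rw [orth_orth] at hw
      rw [Matrix.sub_mulVec, he w hw, sub_self]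
    · refine sup_le ((soSub_le_span_wedge hcompl).trans hspan) ?_
      intro X hX
      exact hX.1

/-! ### Type III -/

/-- Here k = h ∩ so(E) is the kernel of the character by which `h` acts on `p`, so it has a
one-dimensional complement. The trace form is definite on k, which permits a generator
trace-orthogonal to k; such a generator centralises k. -/
theorem IsWittPair.isTypeIII {p q : Vec n} (hpq : IsWittPair p q) {h : LieSubalgebra ℝ (Mat n)}
    (hso : h ≤ so n) {A : Mat n} (hA : A ∈ h) (hAp : A *ᵥ p = p)
    (hline : ∀ X ∈ h, ∃ c : ℝ, X *ᵥ p = c • p ∧ X *ᵥ q = -c • q) : IsTypeIII p q h := by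
  set k := h ⊓ soSub (spaceE p q) with hk
  have hpos := traceForm_pos_of_timelike (k := k) (v := p - q) (by rw [hpq.g_sub]; norm_num)
    (fun X hX => hso hX.1) fun X hX => by
      have := mulVec_of_mem_soSub_spaceE hX.2
      rw [Matrix.mulVec_sub, this.1, this.2, sub_zero]
  -- correct `A` to become trace-orthogonal to `k`
  let φ : k →ₗ[ℝ] ℝ :=
    { toFun := fun Y => -(A * (Y : Mat n)).trace
      map_add' := fun X Y => by simp [mul_add]; ring
      map_smul' := fun c X => by simp }
  obtain ⟨Y₀, hY₀⟩ : ∃ Y₀, traceForm k Y₀ = φ := by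
    have hinj : Function.Injective (traceForm k : k →ₗ[ℝ] k →ₗ[ℝ] ℝ) := by
      rw [← LinearMap.ker_eq_bot, LinearMap.ker_eq_bot']
      intro X hX
      by_contra h0
      exact (hpos X h0).ne' (by rw [hX]; rfl)
    exact (LinearMap.injective_iff_surjective_of_finrank_eq_finrank
      (Subspace.dual_finrank_eq (K := ℝ) (V := k)).symm).1 hinj φ
  set d := A - (Y₀ : Mat n) with hd
  have hdh : d ∈ h := sub_mem hA Y₀.2.1
  have hdp : d *ᵥ p = p := by
    rw [hd, Matrix.sub_mulVec, (mulVec_of_mem_soSub_spaceE Y₀.2.2).1, hAp, sub_zero]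
  have hdq : d *ᵥ q = -q := by
    obtain ⟨c, h1, h2⟩ := hline d hdh
    have hc : c = 1 := by
      have h3 := congrArg (g n q) (hdp.symm.trans h1)
      rw [map_smul, hpq.pair', smul_eq_mul, mul_one] at h3
      exact h3.symm
    rw [h2, hc, neg_smul, one_smul]
  have hdtr : ∀ Y ∈ k, (d * Y).trace = 0 := by
    intro Y hY
    have h1 : -((Y₀ : Mat n) * Y).trace = -(A * Y).trace := LinearMap.congr_fun hY₀ ⟨Y, hY⟩
    rw [hd, sub_mul, Matrix.trace_sub]
    linarith
  have hcent : ∀ X ∈ k, ⁅d, X⁆ = 0 := by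
    intro X hX
    obtain ⟨hXp, hXq⟩ := mulVec_of_mem_soSub_spaceE hX.2
    have hmem : ⁅d, X⁆ ∈ k := by
      refine ⟨h.lie_mem hdh hX.1, mem_soSub_spaceE ((so n).lie_mem (hso hdh) (hso hX.1)) ?_ ?_⟩
      · rw [lie_mulVec, hXp, hdp, hXp, Matrix.mulVec_zero, sub_zero]
      · rw [lie_mulVec, hXq, hdq, Matrix.mulVec_neg, hXq, Matrix.mulVec_zero, neg_zero, sub_zero]
    by_contra h0
    -- By invariance the square of [d, X] is the trace pairing of d with an element of k, which is
    -- zero.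
    have h1 := hpos ⟨_, hmem⟩ fun h => h0 (congrArg Subtype.val h)
    rw [traceForm_apply, trace_lie_mul, hdtr _ (k.lie_mem hX hmem)] at h1
    simp at h1
  have hC : d - wedge p q ∈ soSub (spaceE p q) := by
    refine mem_soSub_spaceE (sub_mem (hso hdh) (wedge_mem_so p q)) ?_ ?_
    · rw [Matrix.sub_mulVec, hdp, hpq.wedge_left, sub_self]
    · rw [Matrix.sub_mulVec, hdq, hpq.wedge_right, sub_self]
  refine ⟨d - wedge p q, hC, k, inf_le_right, fun X hX => ?_, ?_, ?_⟩
  · obtain ⟨hXp, hXq⟩ := mulVec_of_mem_soSub_spaceE hX.2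
    rw [sub_lie, hcent X hX, ← lie_skew, lie_wedge (hso hX.1), hXp, hXq, wedge_zero_left,
      wedge_zero_right]
    simp
  · rw [add_sub_cancel, Submodule.disjoint_def]
    intro X hX hXk
    obtain ⟨c, rfl⟩ := Submodule.mem_span_singleton.1 hX
    have h1 := (mulVec_of_mem_soSub_spaceE hXk.2).1
    rw [Matrix.smul_mulVec, hdp] at h1
    rw [(smul_eq_zero.1 h1).resolve_right hpq.left_ne_zero, zero_smul]
  · rw [add_sub_cancel]
    apply le_antisymm
    · intro X hX
      obtain ⟨c, h1, h2⟩ := hline X hX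
      rw [show X = c • d + (X - c • d) by abel]
      refine Submodule.add_mem_sup (Submodule.mem_span_singleton.2 ⟨c, rfl⟩)
        ⟨sub_mem hX (h.smul_mem c hdh), ?_⟩
      refine mem_soSub_spaceE (sub_mem (hso hX) ((so n).smul_mem c (hso hdh))) ?_ ?_
      · rw [Matrix.sub_mulVec, Matrix.smul_mulVec, hdp, h1, sub_self]
      · rw [Matrix.sub_mulVec, Matrix.smul_mulVec, hdq, h2]; simp
    · refine sup_le ?_ fun X hX => hX.1
      rw [Submodule.span_singleton_le_iff_mem]
      exact hdh

/-! ### The classification of totally reducible subalgebras -/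

theorem exists_isTypeI {h : LieSubalgebra ℝ (Mat n)} (hso : h ≤ so n) {v : Vec n}
    (hv : g n v v < 0) (hkill : ∀ X ∈ h, X *ᵥ v = 0) : ∃ a ∈ SO0 n, IsTypeI (conj a h) := by
  obtain ⟨a, ha, c, hc, hac⟩ := exists_SO0_mulVec_time hv
  refine ⟨a, ha, ?_⟩
  rintro _ ⟨X, hX, rfl⟩
  refine ⟨conj_mem_so ha (hso hX), fun w hw => ?_⟩
  rw [euclideanHyperplane, orth_orth] at hw
  obtain ⟨b, rfl⟩ := Submodule.mem_span_singleton.1 hw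
  have h1 : (Pi.single 0 1 : Vec n) = c⁻¹ • ((a : Mat n) *ᵥ v) := by
    rw [hac, smul_smul, inv_mul_cancel₀ hc, one_smul]
  rw [h1, Matrix.mulVec_smul, Matrix.mulVec_smul, conj_mulVec, hkill X hX]
  simp

/-- The orthogonal complement of an invariant complement of ℝp is invariant and meets the hyperplane
orthogonal to `p` only in zero, so it is a line not orthogonal to `p`. Skewness fixes the eigenvalue
on it as -c. -/
theorem exists_orthogonal_eigenvector {h : LieSubalgebra ℝ (Mat n)} (hso : h ≤ so n)
    (hTR : TotallyReducible (h : Set (Mat n))) {p : Vec n} (hp0 : p ≠ 0) (hp : g n p p = 0)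
    (hline : ∀ X ∈ h, ∃ c : ℝ, X *ᵥ p = c • p) :
    ∃ q, IsWittPair p q ∧ ∀ X ∈ h, ∃ c : ℝ, X *ᵥ p = c • p ∧ X *ᵥ q = -c • q := by
  obtain ⟨W, hW, hc⟩ := hTR (Submodule.span ℝ {p}) (by
    intro X hX u hu
    obtain ⟨b, rfl⟩ := Submodule.mem_span_singleton.1 hu
    obtain ⟨c, hc⟩ := hline X hX
    rw [Matrix.mulVec_smul, hc]
    exact Submodule.smul_mem _ _ (Submodule.smul_mem _ _ (Submodule.mem_span_singleton_self p)))
  have hdec : ∀ z, g n p z = 0 → z ∈ orth W → z = 0 := by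
    intro z h1 h2
    refine eq_zero_of_g_eq_zero fun u => ?_
    obtain ⟨y, hy, w, hw, rfl⟩ := Submodule.mem_sup.1
      (show u ∈ Submodule.span ℝ {p} ⊔ W by rw [hc.sup_eq_top]; trivial)
    obtain ⟨b, rfl⟩ := Submodule.mem_span_singleton.1 hy
    simp [h1, h2 w hw]
  have hWtop : orth W ≠ ⊥ := by
    intro h0
    have h1 : W = ⊤ := by
      rw [← orth_orth W, h0]; exact LinearMap.BilinForm.orthogonal_bot
    have h2 : p ∈ W := by rw [h1]; trivial
    exact hp0 (Submodule.disjoint_def.1 hc.disjoint p (Submodule.mem_span_singleton_self p) h2)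
  obtain ⟨r, hr, hr0⟩ := Submodule.exists_mem_ne_zero_of_ne_bot hWtop
  have hpr : g n p r ≠ 0 := fun h0 => hr0 (hdec r h0 hr)
  obtain ⟨s, hsW, hps⟩ : ∃ s ∈ orth W, g n p s = 1 :=
    ⟨(g n p r)⁻¹ • r, Submodule.smul_mem _ _ hr, by
      rw [map_smul, smul_eq_mul, inv_mul_cancel₀ hpr]⟩
  -- `s` spans the invariant line but may fail to be null. Because c · g(s,s) = 0 for every element,
  -- the correcting multiple of `p` is zero or is killed by `h`.
  set q := s - (g n s s / 2) • p with hq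
  refine ⟨q, ⟨hp, ?_, ?_⟩, fun X hX => ?_⟩
  · simp only [hq, map_sub, map_smul, LinearMap.sub_apply, LinearMap.smul_apply, smul_eq_mul, hp,
      hps, g_comm s p]
    ring
  · simp [hq, hps, hp]
  · obtain ⟨c, hc⟩ := hline X hX
    refine ⟨c, hc, ?_⟩
    have h1 : g n p (X *ᵥ s) = -c := by
      have := so_skew (hso hX) p s
      rw [hc, map_smul, LinearMap.smul_apply, hps, smul_eq_mul, mul_one] at this
      linarith
    have hXs : X *ᵥ s = -c • s := by
      rw [← sub_eq_zero]
      refine hdec _ ?_ (sub_mem (orth_invariant (hso hX) (fun u hu => hW X hX u hu) hsW)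
        (Submodule.smul_mem _ _ hsW))
      rw [map_sub, map_smul, h1, hps]; simp
    have h2 : c * g n s s = 0 := by
      have := so_self (hso hX) s
      rw [hXs, map_smul, smul_eq_mul] at this
      linarith
    rw [hq, Matrix.mulVec_sub, Matrix.mulVec_smul, hc, hXs]
    have h3 : (g n s s / 2) • c • p = 0 := by
      rw [smul_smul, show g n s s / 2 * c = c * g n s s / 2 by ring, h2]; simp
    have h4 : -c • (g n s s / 2) • p = 0 := by
      rw [smul_smul, show -c * (g n s s / 2) = -(c * g n s s) / 2 by ring, h2]; simp
    rw [smul_sub, h3, h4]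

/-- Skewness makes X conjugate to -Xᵀ through the Gram matrix, so -c is an eigenvalue along with c.
Eigenvectors for nonzero eigenvalues are null, and these two are not orthogonal, as orthogonal null
vectors are proportional. -/
theorem Hyperbolic.exists_wittPair {X : Mat n} (hX : X ∈ so n) (h : Hyperbolic X) :
    ∃ p q : Vec n, ∃ c : ℝ, c ≠ 0 ∧ IsWittPair p q ∧ X *ᵥ p = c • p ∧ X *ᵥ q = -c • q := by
  obtain ⟨p, hp0, c, hc, hXp⟩ := h
  have hp : g n p p = 0 := by
    have := so_self hX p
    rw [hXp, map_smul, smul_eq_mul] at this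
    exact (mul_eq_zero.1 this).resolve_left hc
  obtain ⟨r, hr0, hr⟩ : ∃ r : Vec n, r ≠ 0 ∧ X *ᵥ r = -c • r := by
    have h1 : (X - c • (1 : Mat n)).det = 0 := by
      rw [← Matrix.exists_mulVec_eq_zero_iff]
      exact ⟨p, hp0, by simp [Matrix.sub_mulVec, Matrix.smul_mulVec, hXp]⟩
    have h2 : (X - c • (1 : Mat n))ᵀ = -(gram n * (X + c • (1 : Mat n)) * gram n) := by
      refine mat_ext fun v => ?_
      simp only [Matrix.transpose_sub, Matrix.transpose_smul, Matrix.transpose_one,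
        Matrix.sub_mulVec, Matrix.neg_mulVec, ← Matrix.mulVec_mulVec, Matrix.add_mulVec,
        Matrix.smul_mulVec, Matrix.one_mulVec, Matrix.mulVec_add, Matrix.mulVec_smul,
        gram_mulVec_gram_mulVec, so_transpose hX]
      abel
    have h3 : (X + c • (1 : Mat n)).det = 0 := by
      have h4 : X + c • (1 : Mat n) = -(gram n * (X - c • (1 : Mat n))ᵀ * gram n) := by
        rw [h2, mul_neg, neg_mul, neg_neg, ← mul_assoc, ← mul_assoc, gram_mul_gram, one_mul,
          mul_assoc, gram_mul_gram, mul_one]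
      rw [h4, Matrix.det_neg, Matrix.det_mul, Matrix.det_mul, Matrix.det_transpose, h1]
      simp
    obtain ⟨r, hr0, hr⟩ := Matrix.exists_mulVec_eq_zero_iff.2 h3
    refine ⟨r, hr0, ?_⟩
    rw [Matrix.add_mulVec, Matrix.smul_mulVec, Matrix.one_mulVec] at hr
    rw [neg_smul]; exact eq_neg_of_add_eq_zero_left hr
  have hrr : g n r r = 0 := by
    have := so_self hX r
    rw [hr, map_smul, smul_eq_mul] at this
    exact (mul_eq_zero.1 this).resolve_left (neg_ne_zero.2 hc)
  have hpr : g n p r ≠ 0 := by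
    intro h0
    obtain ⟨b, rfl⟩ := (g_self_nonneg_of_orth hp.le hp0 h0).2 hrr
    rw [Matrix.mulVec_smul, hXp, smul_comm, neg_smul, eq_neg_iff_add_eq_zero, ← two_smul ℝ,
      smul_smul] at hr
    exact hr0 ((smul_eq_zero.1 hr).resolve_left (mul_ne_zero two_ne_zero hc))
  refine ⟨p, (g n p r)⁻¹ • r, c, hc, ⟨hp, ?_, ?_⟩, hXp, ?_⟩
  · simp [hrr]
  · rw [map_smul, smul_eq_mul, inv_mul_cancel₀ hpr]
  · rw [Matrix.mulVec_smul, hr, smul_comm]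

theorem exists_conj_type {p q : Vec n} (hpq : IsWittPair p q) {h : LieSubalgebra ℝ (Mat n)}
    (hso : h ≤ so n) (hTR : TotallyReducible (h : Set (Mat n))) :
    ∃ a ∈ SO0 n, IsTypeI (conj a h) ∨ IsTypeII p q (conj a h) ∨ IsTypeIII p q (conj a h) := by
  -- moving the Witt pair of a hyperbolic element to the given one
  have hmove : ∀ X ∈ h, ∀ p' q' : Vec n, ∀ c : ℝ, c ≠ 0 → IsWittPair p' q' → X *ᵥ p' = c • p' →
      X *ᵥ q' = -c • q' → ∃ a ∈ SO0 n, (∃ A ∈ conj a h, A *ᵥ p = p ∧ A *ᵥ q = -q) ∧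
        ((∃ b : ℝ, b ≠ 0 ∧ (a : Mat n) *ᵥ p' = b • p ∧ (a : Mat n) *ᵥ q' = b⁻¹ • q) ∨
          ∃ b : ℝ, b ≠ 0 ∧ (a : Mat n) *ᵥ p' = b • q ∧ (a : Mat n) *ᵥ q' = b⁻¹ • p) := by
    intro X hX p' q' c hc hw h1 h2
    obtain ⟨a, ha, b, hb, hab⟩ := exists_SO0_wittPair hpq hw
    have hmem : a.1 * X * (a⁻¹).1 ∈ conj a h := ⟨X, hX, rfl⟩
    rcases hab with hab | hab
    · refine ⟨a, ha, ⟨c⁻¹ • (a.1 * X * (a⁻¹).1), (conj a h).smul_mem _ hmem, ?_, ?_⟩,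
        Or.inl ⟨b, hb, hab⟩⟩
      · rw [Matrix.smul_mulVec, conj_mulVec_eq a hb hab.1 h1, smul_smul,
          inv_mul_cancel₀ hc, one_smul]
      · rw [Matrix.smul_mulVec, conj_mulVec_eq a (inv_ne_zero hb) hab.2 h2, smul_smul, mul_neg,
          inv_mul_cancel₀ hc, neg_smul, one_smul]
    -- The conjugation exchanged the two null lines, so the eigenvalue on `p` is now -c.
    · refine ⟨a, ha, ⟨(-c)⁻¹ • (a.1 * X * (a⁻¹).1), (conj a h).smul_mem _ hmem, ?_, ?_⟩,
        Or.inr ⟨b, hb, hab⟩⟩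
      · rw [Matrix.smul_mulVec, conj_mulVec_eq a (inv_ne_zero hb) hab.2 h2, smul_smul,
          inv_mul_cancel₀ (neg_ne_zero.2 hc), one_smul]
      · rw [Matrix.smul_mulVec, conj_mulVec_eq a hb hab.1 h1, smul_smul, inv_neg, neg_mul,
          inv_mul_cancel₀ hc, neg_smul, one_smul]
  by_cases hnull : ∀ v : Vec n, v ≠ 0 → g n v v = 0 → ∃ X ∈ h, ∀ c : ℝ, X *ᵥ v ≠ c • v
  · by_cases hnh : ∀ X ∈ h, ¬Hyperbolic X
    · obtain ⟨v, hv, hkill⟩ := exists_timelike_of_not_hyperbolic hso hTR hnh hnull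
      obtain ⟨a, ha, h1⟩ := exists_isTypeI hso hv hkill
      exact ⟨a, ha, Or.inl h1⟩
    · push Not at hnh
      obtain ⟨X, hX, hyp⟩ := hnh
      obtain ⟨p', q', c, hc, hw, h1, h2⟩ := hyp.exists_wittPair (hso hX)
      obtain ⟨a, ha, ⟨A, hA, hAp, hAq⟩, -⟩ := hmove X hX p' q' c hc hw h1 h2
      have hnull' : ∀ v : Vec n, v ≠ 0 → g n v v = 0 →
          ∃ Y ∈ conj a h, ∀ c : ℝ, Y *ᵥ v ≠ c • v := by
        intro v hv0 hv
        obtain ⟨Y, hY, hYc⟩ := hnull ((a⁻¹).1 *ᵥ v) (coe_mulVec_ne_zero a⁻¹ hv0)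
          (by rw [g_mulVec_of_mem_SO0 (inv_mem ha), hv])
        refine ⟨_, ⟨Y, hY, rfl⟩, fun c hc => hYc c ?_⟩
        rw [← Matrix.mulVec_smul, ← hc, ← Matrix.mulVec_mulVec, ← Matrix.mulVec_mulVec,
          coe_inv_mulVec]
      exact ⟨a, ha, Or.inr (Or.inl (hpq.isTypeII (conj_le_so ha hso) hA hAp hAq
        (hnull' p hpq.left_ne_zero hpq.left) (hnull' q hpq.symm.left_ne_zero hpq.right)))⟩
  · push Not at hnull
    obtain ⟨p', hp0, hp, hline⟩ := hnull
    obtain ⟨q', hw, hline⟩ := exists_orthogonal_eigenvector hso hTR hp0 hp hline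
    -- The character on the invariant null line is either trivial, and then the timelike p' - q' is
    -- killed, or gives a hyperbolic element.
    by_cases hzero : ∀ X ∈ h, X *ᵥ p' = 0 ∧ X *ᵥ q' = 0
    · obtain ⟨a, ha, h1⟩ := exists_isTypeI hso (v := p' - q') (by rw [hw.g_sub]; norm_num)
        fun X hX => by rw [Matrix.mulVec_sub, (hzero X hX).1, (hzero X hX).2, sub_zero]
      exact ⟨a, ha, Or.inl h1⟩
    · push Not at hzero
      obtain ⟨X, hX, hXz⟩ := hzero
      obtain ⟨c, h1, h2⟩ := hline X hX
      have hc : c ≠ 0 := by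
        rintro rfl
        exact hXz (by simpa using h1) (by simpa using h2)
      obtain ⟨a, ha, ⟨A, hA, hAp, -⟩, hab⟩ := hmove X hX p' q' c hc hw h1 h2
      refine ⟨a, ha, Or.inr (Or.inr (hpq.isTypeIII (conj_le_so ha hso) hA hAp ?_))⟩
      rintro _ ⟨Y, hY, rfl⟩
      obtain ⟨d, h3, h4⟩ := hline Y hY
      rcases hab with ⟨b, hb, h5, h6⟩ | ⟨b, hb, h5, h6⟩
      · exact ⟨d, conj_mulVec_eq a hb h5 h3, conj_mulVec_eq a (inv_ne_zero hb) h6 h4⟩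
      · exact ⟨-d, conj_mulVec_eq a (inv_ne_zero hb) h6 h4, by
          rw [neg_neg]; exact conj_mulVec_eq a hb h5 h3⟩

/-! ### Connected subgroups and their Lie algebras -/

theorem le_so_of_lieSubgroup_le {h : LieSubalgebra ℝ (Mat n)} (hG : lieSubgroup h ≤ SO ⊤) :
    h ≤ so n := fun _ hX => mem_so_of_g_exp_mulVec fun t =>
  (hG (expGL_mem_lieSubgroup (h.smul_mem t hX))).1

theorem expGL_neg (X : Mat n) : expGL (-X) = (expGL X)⁻¹ := by
  refine eq_inv_of_mul_eq_one_left (Units.ext ?_)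
  rw [Units.val_mul, coe_expGL, coe_expGL, Units.val_one,
    ← Matrix.exp_add_of_commute _ _ (Commute.refl X).neg_left, neg_add_cancel,
    NormedSpace.exp_zero]

theorem expGL_add {X Y : Mat n} (h : ⁅X, Y⁆ = 0) : expGL (X + Y) = expGL X * expGL Y :=
  Units.ext <| by
    rw [Units.val_mul, coe_expGL, coe_expGL, coe_expGL,
      Matrix.exp_add_of_commute _ _ (sub_eq_zero.1 h)]

/-- Carries total reducibility from the group to its algebra. One direction differentiates exp(tX)u
at 0; the other uses that the stabiliser of `U` is a subgroup containing the exponentials. -/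
theorem invariant_lieSubgroup_iff {h : LieSubalgebra ℝ (Mat n)} {U : Submodule ℝ (Vec n)} :
    Invariant {A : Mat n | ∃ x ∈ lieSubgroup h, A = (x : Mat n)} U ↔
      Invariant (h : Set (Mat n)) U := by
  constructor
  · intro hU X hX u hu
    exact mulVec_mem_of_exp fun t =>
      hU _ ⟨_, expGL_mem_lieSubgroup (h.smul_mem t hX), rfl⟩ u hu
  · intro hU
    let K : Subgroup (GL (Fin (n + 2)) ℝ) :=
      { carrier := {a | (∀ u ∈ U, (a : Mat n) *ᵥ u ∈ U) ∧
          ∀ u ∈ U, ((a⁻¹ : GL (Fin (n + 2)) ℝ) : Mat n) *ᵥ u ∈ U}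
        mul_mem' := fun {a b} ha hb => by
          refine ⟨fun u hu => ?_, fun u hu => ?_⟩
          · rw [Units.val_mul, ← Matrix.mulVec_mulVec]
            exact ha.1 _ (hb.1 _ hu)
          · rw [mul_inv_rev, Units.val_mul, ← Matrix.mulVec_mulVec]
            exact hb.2 _ (ha.2 _ hu)
        one_mem' := by simp
        inv_mem' := fun {a} ha => ⟨ha.2, by rw [inv_inv]; exact ha.1⟩ }
    have hle : lieSubgroup h ≤ K := lieSubgroup_le_iff.2 fun X hX =>
      ⟨fun u hu => exp_mulVec_mem (hU X hX) hu, fun u hu => by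
        rw [← expGL_neg]
        exact exp_mulVec_mem (hU (-X) (neg_mem (S := LieSubalgebra ℝ (Mat n)) hX)) hu⟩
    rintro _ ⟨a, ha, rfl⟩ u hu
    exact (hle ha).1 u hu

theorem conjGroup_lieSubgroup (a : GL (Fin (n + 2)) ℝ) (h : LieSubalgebra ℝ (Mat n)) :
    conjGroup a (lieSubgroup h) = lieSubgroup (conj a h) := by
  have hexp : ∀ X : Mat n, MulAut.conj a (expGL X) = expGL (a.1 * X * (a⁻¹).1) := fun X =>
    Units.ext (Matrix.exp_units_conj a X).symm
  rw [conjGroup]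
  apply le_antisymm
  · rw [Subgroup.map_le_iff_le_comap, lieSubgroup_le_iff]
    intro X hX
    rw [Subgroup.mem_comap]
    exact (hexp X).symm ▸ expGL_mem_lieSubgroup ⟨X, hX, rfl⟩
  · rw [lieSubgroup_le_iff]
    rintro _ ⟨X, hX, rfl⟩
    rw [← hexp]
    exact Subgroup.mem_map_of_mem _ (expGL_mem_lieSubgroup hX)

/-- The product of two commuting subgroups is itself a subgroup, so it is enough to factor the
generators. -/
theorem lieSubgroup_eq_mul {h : LieSubalgebra ℝ (Mat n)} {A B : Subgroup (GL (Fin (n + 2)) ℝ)}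
    (hA : A ≤ lieSubgroup h) (hB : B ≤ lieSubgroup h) (hAB : ∀ a ∈ A, ∀ b ∈ B, a * b = b * a)
    (hexp : ∀ X ∈ h, ∃ a ∈ A, ∃ b ∈ B, expGL X = a * b) :
    (lieSubgroup h : Set (GL (Fin (n + 2)) ℝ)) =
      (A : Set (GL (Fin (n + 2)) ℝ)) * (B : Set (GL (Fin (n + 2)) ℝ)) := by
  let P : Subgroup (GL (Fin (n + 2)) ℝ) :=
    { carrier := {x | ∃ a ∈ A, ∃ b ∈ B, x = a * b}
      mul_mem' := by
        rintro _ _ ⟨a, ha, b, hb, rfl⟩ ⟨a', ha', b', hb', rfl⟩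
        refine ⟨a * a', mul_mem ha ha', b * b', mul_mem hb hb', ?_⟩
        rw [mul_assoc a b, ← mul_assoc b, ← hAB a' ha' b hb, mul_assoc a', ← mul_assoc a]
      one_mem' := ⟨1, one_mem _, 1, one_mem _, by simp⟩
      inv_mem' := by
        rintro _ ⟨a, ha, b, hb, rfl⟩
        refine ⟨a⁻¹, inv_mem ha, b⁻¹, inv_mem hb, ?_⟩
        rw [hAB a ha b hb, mul_inv_rev] }
  ext x
  constructor
  · intro hx
    obtain ⟨a, ha, b, hb, rfl⟩ := (lieSubgroup_le_iff (K := P)).2 hexp hx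
    exact Set.mul_mem_mul ha hb
  · rintro ⟨a, ha, b, hb, rfl⟩
    exact mul_mem (hA ha) (hB hb)

theorem expGL_comm {X Y : Mat n} (h : ⁅X, Y⁆ = 0) : expGL X * expGL Y = expGL Y * expGL X := by
  rw [← expGL_add h, ← expGL_add (by rw [← lie_skew, h, neg_zero]), add_comm X Y]

theorem expGL_comm_lieSubgroup {X : Mat n} {k : LieSubalgebra ℝ (Mat n)}
    (h : ∀ Y ∈ k, ⁅X, Y⁆ = 0) : ∀ b ∈ lieSubgroup k, expGL X * b = b * expGL X := by
  have hle : lieSubgroup k ≤ Subgroup.centralizer {expGL X} := lieSubgroup_le_iff.2 fun Y hY => by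
    rw [Subgroup.mem_centralizer_singleton_iff]
    exact (expGL_comm (h Y hY)).symm
  intro b hb
  exact (Subgroup.mem_centralizer_singleton_iff.1 (hle hb)).symm

theorem lieSubgroup_comm {k k' : LieSubalgebra ℝ (Mat n)} (h : ∀ X ∈ k, ∀ Y ∈ k', ⁅X, Y⁆ = 0) :
    ∀ a ∈ lieSubgroup k, ∀ b ∈ lieSubgroup k', a * b = b * a := by
  intro a ha b hb
  have hle : lieSubgroup k ≤ Subgroup.centralizer {b} := lieSubgroup_le_iff.2 fun X hX => by
    rw [Subgroup.mem_centralizer_singleton_iff]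
    exact expGL_comm_lieSubgroup (h X hX) b hb
  exact Subgroup.mem_centralizer_singleton_iff.1 (hle ha)

/-- The one-parameter group generated by a matrix. -/
noncomputable def oneParam (X : Mat n) : Multiplicative ℝ →* GL (Fin (n + 2)) ℝ where
  toFun t := expGL (t.toAdd • X)
  map_one' := Units.ext (by simp [coe_expGL])
  map_mul' s t := by
    rw [toAdd_mul, add_smul, expGL_add]
    rw [smul_lie, lie_smul, lie_self, smul_zero, smul_zero]

section Exponential

open scoped Matrix.Norms.Operator

theorem continuous_oneParam (X : Mat n) : Continuous (oneParam X) := by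
  have h1 : ∀ X : Mat n, Continuous fun t : Multiplicative ℝ =>
      NormedSpace.exp (t.toAdd • X) := fun X =>
    (continuous_iff_continuousAt.2 fun t : ℝ =>
      (hasDerivAt_exp_smul_const (𝕂 := ℝ) X t).continuousAt).comp continuous_toAdd
  rw [Units.continuous_iff]
  refine ⟨h1 X, ?_⟩
  convert! h1 (-X) using 2 with t
  change (((expGL (t.toAdd • X))⁻¹ : GL (Fin (n + 2)) ℝ) : Mat n) = _
  rw [← expGL_neg, coe_expGL, smul_neg]

end Exponential

/-! ### Groups of the three types -/

theorem IsTypeI.group {h : LieSubalgebra ℝ (Mat n)} (H : IsTypeI h) :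
    IsGroupTypeI (lieSubgroup h) :=
  ⟨⟨h, rfl⟩, lieSubgroup_le_SO H⟩

theorem lie_eq_zero_of_mem_soSub_orth {W : Submodule ℝ (Vec n)} {X Y : Mat n} (hX : X ∈ soSub W)
    (hY : Y ∈ soSub (orth W)) : ⁅X, Y⁆ = 0 := by
  refine mat_ext fun v => ?_
  rw [lie_mulVec, hX.2 _ (mulVec_mem_of_mem_soSub hY v),
    hY.2 _ (by rw [orth_orth]; exact mulVec_mem_of_mem_soSub hX v), sub_self, Matrix.zero_mulVec]

theorem IsTypeII.group {p q : Vec n} {h : LieSubalgebra ℝ (Mat n)} (H : IsTypeII p q h) :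
    IsGroupTypeII p q (lieSubgroup h) := by
  obtain ⟨H, hH, hdim, k, hk, -, he⟩ := H
  have h1 : soSub (spaceV p q H) ≤ h := fun X hX => by
    change X ∈ h.toSubmodule
    rw [he]; exact Submodule.mem_sup_left hX
  have h2 : k ≤ h := fun X hX => by
    change X ∈ h.toSubmodule
    rw [he]; exact Submodule.mem_sup_right hX
  refine ⟨H, hH, hdim, lieSubgroup k, ⟨k, rfl⟩, lieSubgroup_le_SO hk,
    lieSubgroup_eq_mul (lieSubgroup_mono h1) (lieSubgroup_mono h2)
      (lieSubgroup_comm fun X hX Y hY => lie_eq_zero_of_mem_soSub_orth hX (hk hY)) ?_⟩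
  intro X hX
  have hX' : X ∈ h.toSubmodule := hX
  rw [he] at hX'
  obtain ⟨Y, hY, Z, hZ, rfl⟩ := Submodule.mem_sup.1 hX'
  exact ⟨_, expGL_mem_lieSubgroup hY, _, expGL_mem_lieSubgroup hZ,
    expGL_add (lie_eq_zero_of_mem_soSub_orth hY (hk hZ))⟩

theorem IsTypeIII.group {p q : Vec n} (hpq : IsWittPair p q) {h : LieSubalgebra ℝ (Mat n)}
    (H : IsTypeIII p q h) : IsGroupTypeIII p q (lieSubgroup h) := by
  obtain ⟨C, hC, k, hk, hCk, -, he⟩ := H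
  set d := wedge p q + C with hd
  have hw0 : ∀ X ∈ soSub (spaceE p q), ⁅wedge p q, X⁆ = 0 := fun X hX => by
    obtain ⟨h1, h2⟩ := mulVec_of_mem_soSub_spaceE hX
    rw [← lie_skew, lie_wedge hX.1, h1, h2, wedge_zero_left, wedge_zero_right]
    simp
  have hdk : ∀ X ∈ k, ⁅d, X⁆ = 0 := fun X hX => by
    rw [hd, add_lie, hw0 X (hk hX), hCk X hX, add_zero]
  have hdh : d ∈ h := by
    change d ∈ h.toSubmodule
    rw [he]; exact Submodule.mem_sup_left (Submodule.mem_span_singleton_self d)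
  have hkh : k ≤ h := fun X hX => by
    change X ∈ h.toSubmodule
    rw [he]; exact Submodule.mem_sup_right hX
  have hcomm : ∀ t ∈ (oneParam d).range, ∀ b ∈ lieSubgroup k, t * b = b * t := by
    rintro _ ⟨t, rfl⟩ b hb
    exact expGL_comm_lieSubgroup (fun Y hY => by rw [smul_lie, hdk Y hY, smul_zero]) b hb
  have hwU : wedge p q ∈ soSub (planeU p q) :=
    ⟨wedge_mem_so p q, fun v hv => wedge_mulVec_spaceE hv⟩
  refine ⟨oneParam d, continuous_oneParam d, ?_, ?_, lieSubgroup k, ⟨k, rfl⟩, lieSubgroup_le_SO hk,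
    hcomm, lieSubgroup_eq_mul ?_ (lieSubgroup_mono hkh) hcomm ?_⟩
  · rintro _ ⟨t, rfl⟩
    have e : oneParam d t = expGL (t.toAdd • wedge p q) * expGL (t.toAdd • C) := by
      rw [← expGL_add, ← smul_add]
      · rfl
      · rw [smul_lie, lie_smul, hw0 C hC, smul_zero, smul_zero]
    rw [e]
    exact Subgroup.mul_mem_sup
      (lieSubgroup_le_SO le_rfl (expGL_mem_lieSubgroup ((soSub _).smul_mem _ hwU)))
      (lieSubgroup_le_SO le_rfl (expGL_mem_lieSubgroup ((soSub _).smul_mem _ hC)))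
  -- At time 1 the one-parameter group multiplies `p` by e, whereas elements of SO(E) fix `p`.
  · intro hle
    have h1 := (hle ⟨Multiplicative.ofAdd 1, rfl⟩).2.2 p (by
      rw [orth_spaceE]; exact Submodule.subset_span (by simp))
    have hdp : ((1 : ℝ) • d) *ᵥ p = (1 : ℝ) • p := by
      rw [one_smul, one_smul, hd, Matrix.add_mulVec, hpq.wedge_left,
        (mulVec_of_mem_soSub_spaceE hC).1, add_zero]
    have h2 : Real.exp 1 • p = p := (exp_mulVec_of_mulVec_eq_smul hdp).symm.trans h1
    have h3 : (Real.exp 1 - 1) • p = 0 := by rw [sub_smul, h2, one_smul, sub_self]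
    have h4 := Real.add_one_lt_exp (one_ne_zero (α := ℝ))
    rcases smul_eq_zero.1 h3 with h5 | h5
    · linarith
    · exact hpq.left_ne_zero h5
  · rintro _ ⟨t, rfl⟩
    exact expGL_mem_lieSubgroup (h.smul_mem _ hdh)
  · intro X hX
    have hX' : X ∈ h.toSubmodule := hX
    rw [he] at hX'
    obtain ⟨Y, hY, Z, hZ, rfl⟩ := Submodule.mem_sup.1 hX'
    obtain ⟨c, rfl⟩ := Submodule.mem_span_singleton.1 hY
    refine ⟨_, ⟨Multiplicative.ofAdd c, rfl⟩, _, expGL_mem_lieSubgroup hZ, ?_⟩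
    exact expGL_add (by rw [smul_lie, hdk Z hZ, smul_zero])

end Lorentz

theorem mainTheorem1 (n : ℕ) (p q : Lorentz.Vec n) (hpq : Lorentz.IsWittPair p q) :
    (∀ h : LieSubalgebra ℝ (Lorentz.Mat n), h ≤ Lorentz.so n →
      Lorentz.TotallyReducible (h : Set (Lorentz.Mat n)) →
      ∃ a ∈ Lorentz.SO0 n,
        Lorentz.IsTypeI (Lorentz.conj a h) ∨ Lorentz.IsTypeII p q (Lorentz.conj a h) ∨
          Lorentz.IsTypeIII p q (Lorentz.conj a h)) ∧
    (∀ G : Subgroup (GL (Fin (n + 2)) ℝ), Lorentz.IsConnectedLieSubgroup G →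
      G ≤ Lorentz.SO ⊤ →
      Lorentz.TotallyReducible {A : Lorentz.Mat n | ∃ x ∈ G, A = (x : Lorentz.Mat n)} →
      ∃ a ∈ Lorentz.SO0 n,
        Lorentz.IsGroupTypeI (Lorentz.conjGroup a G) ∨
          Lorentz.IsGroupTypeII p q (Lorentz.conjGroup a G) ∨
          Lorentz.IsGroupTypeIII p q (Lorentz.conjGroup a G)) := by
  refine ⟨fun h hso hTR => Lorentz.exists_conj_type hpq hso hTR, ?_⟩
  rintro _ ⟨h, rfl⟩ hSO hTR
  have hTR' : Lorentz.TotallyReducible (h : Set (Lorentz.Mat n)) := by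
    intro U hU
    obtain ⟨U', hU', hc⟩ := hTR U (Lorentz.invariant_lieSubgroup_iff.2 hU)
    exact ⟨U', Lorentz.invariant_lieSubgroup_iff.1 hU', hc⟩
  obtain ⟨a, ha, H⟩ := Lorentz.exists_conj_type hpq (Lorentz.le_so_of_lieSubgroup_le hSO) hTR'
  refine ⟨a, ha, ?_⟩
  rw [Lorentz.conjGroup_lieSubgroup]
  exact H.imp Lorentz.IsTypeI.group (Or.imp Lorentz.IsTypeII.group (Lorentz.IsTypeIII.group hpq))
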